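/- **Theorem (Lower bound on the step size).** Let $n,p$ be integers with $n\ge 0$, $p\ge 3$, and put $p'=p+1$ if $p$ is odd, $p'=p+2$ if $p$ is even. Fix $L>0$, $\Lambda_1,\dots,\Lambda_p\in\mathbb R$, $\eta\in(0,1)$, $\gamma_1>1>\gamma_2>0$ and $\sigma_{\min}>0$. Then there are constants $\hat\kappa_3,\hat\kappa_4>0$, depending only on these data and $n$ (not on $\epsilon$, $k$, $a$ or $f$), such that the following holds. Let $f:\mathbb R^n\to\mathbb R$ be $p$ times continuously differentiable and bounded below, with $\|\nabla^p f(x)-\nabla^p f(y)\|\le (p-1)!\,L\,\|x-y\|$ for all $x,y$, where $\|\cdot\|$ on tensors is $\|T\|=\sup_{\|v_1\|=\dots=\|v_j\|=1}|T[v_1,\dots,v_j]|$. Let $0<\epsilon<1$, $a\in[0,\tfrac12]$, $\delta=\epsilon^a$, and consider a run of the following method, along which $\|\nabla^j f(x_k)\|\le\Lambda_j$ for all iterates $x_k$ produced and $1\le j\le p$. *Method.* Start with $x_0=0$ and $\sigma^r_0=\sigma_{\min}$. For $k=0,1,2,\dots$: stop if $\|\nabla f(x_k)\|\le\epsilon$.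 Otherwise let $\lambda_k$ be the smallest eigenvalue of $\nabla^2f(x_k)$, $T_p(x_k,s)=\sum_{j=0}^p\frac1{j!}\nabla^jf(x_k)[s]^j$, and $$m_\sigma(s)=T_p(x_k,s)+\tfrac{\mu_k}{2}\|s\|^2+\tfrac{\sigma}{p'}\|s\|^{p'},$$ where $\mu_k=0$ in Case 1 (locally strongly convex, $\lambda_k\ge\delta$), $\mu_k=-\lambda_k+\delta$ in Case 2 (locally nonconvex, $\lambda_k\le0$), $\mu_k=\delta$ in Case 3 (locally nearly strongly convex, $0<\lambda_k\le\delta$); if $\lambda_k=\delta$, either of Cases 1 and 3 may be used. Let $\bar\sigma_k$ be the least $\sigma\ge0$ for which $m_\sigma$ is SoS-convex (that is, its Hessian equals $V(s)^TV(s)$ for some polynomial matrix $V$), let $\sigma_k=\max\{\bar\sigma_k,\sigma^r_k\}$, let $s_k$ be a global minimizer of $m_{\sigma_k}$, and let $\rho_k=\dfrac{f(x_k)-f(x_k+s_k)}{f(x_k)-T_p(x_k,s_k)}$. If $\rho_k>\eta$, set $x_{k+1}=x_k+s_k$ and $\sigma^r_{k+1}=\max\{\gamma_2\sigma_k,\sigma_{\min}\}$;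 otherwise set $x_{k+1}=x_k$ and $\sigma^r_{k+1}=\gamma_1\sigma_k$. Then for every iteration $k\ge0$ that is carried out (i.e. $\|\nabla f(x_j)\|>\epsilon$ for all $j\le k$): - Case 1: if $\|\nabla f(x_k+s_k)\|>\epsilon$, then $\displaystyle\|s_k\|>\tfrac12\min\Big\{\Big(\frac{\epsilon}{L}\Big)^{1/p},\Big(\frac{\epsilon}{\sigma_k}\Big)^{1/(p'-1)}\Big\}$; - Case 2: $\|s_k\|>\hat\kappa_3\,\epsilon$; - Case 3: if $\|\nabla f(x_k+s_k)\|>\epsilon$, then $\|s_k\|>\hat\kappa_4\,\epsilon^{1-a}$. -/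

import Mathlib

/-- A symmetric polynomial matrix in `n` variables is an SoS-matrix if it is `Vᵀ V` for some
(rectangular) polynomial matrix `V`. -/
def IsSoSMatrix {n : ℕ} (H : Matrix (Fin n) (Fin n) (MvPolynomial (Fin n) ℝ)) : Prop :=
  ∃ (m : ℕ) (V : Matrix (Fin m) (Fin n) (MvPolynomial (Fin n) ℝ)), H = V.transpose * V

/-- The Hessian matrix of a polynomial, with polynomial entries. -/
noncomputable def polyHessian {n : ℕ} (q : MvPolynomial (Fin n) ℝ) :
    Matrix (Fin n) (Fin n) (MvPolynomial (Fin n) ℝ) :=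
  Matrix.of fun i j => MvPolynomial.pderiv i (MvPolynomial.pderiv j q)

/-- A function on `ℝⁿ` is SoS-convex if it is given by a (necessarily unique) polynomial
whose Hessian is an SoS-matrix. -/
def IsSoSConvex {n : ℕ} (m : EuclideanSpace ℝ (Fin n) → ℝ) : Prop :=
  ∃ q : MvPolynomial (Fin n) ℝ,
    (∀ s : EuclideanSpace ℝ (Fin n), m s = MvPolynomial.eval (fun i => s i) q) ∧
      IsSoSMatrix (polyHessian q)

/-- The `p`th order Taylor polynomial `T_p(x, s) = ∑_{j ≤ p} (1 / j!) ∇ʲf(x)[s]ʲ`. -/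
noncomputable def taylorModel {n : ℕ} (p : ℕ) (f : EuclideanSpace ℝ (Fin n) → ℝ)
    (x s : EuclideanSpace ℝ (Fin n)) : ℝ :=
  ∑ j ∈ Finset.range (p + 1), (1 / (j.factorial : ℝ)) * iteratedFDeriv ℝ j f x (fun _ => s)

/-- The Hessian matrix `∇²f(x)`. -/
noncomputable def hessianMatrix {n : ℕ} (f : EuclideanSpace ℝ (Fin n) → ℝ)
    (x : EuclideanSpace ℝ (Fin n)) : Matrix (Fin n) (Fin n) ℝ :=
  Matrix.of fun i j =>
    iteratedFDeriv ℝ 2 f x ![EuclideanSpace.single i (1 : ℝ), EuclideanSpace.single j (1 : ℝ)]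

/-- The smallest eigenvalue `λ_min[∇²f(x)]` of the Hessian. -/
noncomputable def lambdaMin {n : ℕ} (f : EuclideanSpace ℝ (Fin n) → ℝ)
    (x : EuclideanSpace ℝ (Fin n)) : ℝ :=
  sInf (spectrum ℝ (hessianMatrix f x))

/-- The power `p'` of the regularization: `p + 1` for odd `p` and `p + 2` for even `p`. -/
def regPower (p : ℕ) : ℕ := if Odd p then p + 1 else p + 2

/-- The three convexity cases of an iteration. -/
inductive ConvexityCase where
  | stronglyConvex
  | nonconvex
  | nearlyStronglyConvex

/-- The condition on `lam = λ_min[∇²f(x_k)]` that defines each case. (If `lam = δ`, the first and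
the third case both apply, and the method may use either.) -/
def ConvexityCase.Applies (δ lam : ℝ) : ConvexityCase → Prop
  | .stronglyConvex => δ ≤ lam
  | .nonconvex => lam ≤ 0
  | .nearlyStronglyConvex => 0 < lam ∧ lam ≤ δ

/-- The multiple of the identity that is added to the Hessian in each case. -/
def ConvexityCase.shift (δ lam : ℝ) : ConvexityCase → ℝ
  | .stronglyConvex => 0
  | .nonconvex => -lam + δ
  | .nearlyStronglyConvex => δ

/-- The SoS Taylor model
`m_c(x, s) = T_p(x, s) + (shift / 2) ‖s‖² + (σ / p') ‖s‖^{p'}` in convexity case `c`. -/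
noncomputable def sosTaylorModel {n : ℕ} (p : ℕ) (f : EuclideanSpace ℝ (Fin n) → ℝ) (δ : ℝ)
    (c : ConvexityCase) (σ : ℝ) (x s : EuclideanSpace ℝ (Fin n)) : ℝ :=
  taylorModel p f x s + c.shift δ (lambdaMin f x) / 2 * ‖s‖ ^ 2
    + σ / (regPower p : ℝ) * ‖s‖ ^ regPower p

/-- `f ∈ C^{p,1}(ℝⁿ)`: `f` is `p` times continuously differentiable, bounded below, and its `p`th
derivative is globally Lipschitz with constant `(p - 1)! L`. The norm of `iteratedFDeriv ℝ j f x`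
is `sup_{‖v₁‖ = ⋯ = ‖v_j‖ = 1} |∇ʲf(x)[v₁, …, v_j]|`. -/
structure IsLipschitzSmooth {n : ℕ} (p : ℕ) (L : ℝ) (f : EuclideanSpace ℝ (Fin n) → ℝ) :
    Prop where
  contDiff : ContDiff ℝ p f
  bddBelow : ∃ flow : ℝ, ∀ x, flow ≤ f x
  lipschitz : ∀ x y, ‖iteratedFDeriv ℝ p f x - iteratedFDeriv ℝ p f y‖
    ≤ ((p - 1).factorial : ℝ) * L * ‖x - y‖

/-- The termination test `‖∇f(x_j)‖ ≤ ε` has failed at `x_0, …, x_k`, so that iteration `k` is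
carried out. -/
def IsActive {n : ℕ} (f : EuclideanSpace ℝ (Fin n) → ℝ) (ε : ℝ)
    (x : ℕ → EuclideanSpace ℝ (Fin n)) (k : ℕ) : Prop :=
  ∀ j ≤ k, ε < ‖gradient f (x j)‖

/-- A run of the adaptive `p`th order regularization method with SoS Taylor models.
Only the entries up to termination are constrained. -/
structure ARpSoSRun {n : ℕ} (p : ℕ) (f : EuclideanSpace ℝ (Fin n) → ℝ)
    (ε δ η γ₁ γ₂ σmin : ℝ) where
  /-- The iterates `x_k`. -/
  x : ℕ → EuclideanSpace ℝ (Fin n)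
  /-- The steps `s_k`. -/
  s : ℕ → EuclideanSpace ℝ (Fin n)
  /-- The convexity cases. -/
  cvx : ℕ → ConvexityCase
  /-- The values `σ̄_k` of the sum of squares programs. -/
  σbar : ℕ → ℝ
  /-- The adaptive parameters `σʳ_k`. -/
  σreg : ℕ → ℝ
  /-- The regularization parameters `σ_k`. -/
  σ : ℕ → ℝ
  /-- The ratios `ρ_k`. -/
  ρ : ℕ → ℝ
  x_zero : x 0 = 0
  σreg_zero : σreg 0 = σmin
  cvx_spec : ∀ k, IsActive f ε x k → (cvx k).Applies δ (lambdaMin f (x k))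
  σbar_spec : ∀ k, IsActive f ε x k →
    IsLeast {τ : ℝ | 0 ≤ τ ∧ IsSoSConvex (sosTaylorModel p f δ (cvx k) τ (x k))} (σbar k)
  σ_spec : ∀ k, IsActive f ε x k → σ k = max (σbar k) (σreg k)
  s_spec : ∀ k, IsActive f ε x k → ∀ s',
    sosTaylorModel p f δ (cvx k) (σ k) (x k) (s k)
      ≤ sosTaylorModel p f δ (cvx k) (σ k) (x k) s'
  ρ_spec : ∀ k, IsActive f ε x k →
    ρ k = (f (x k) - f (x k + s k)) / (f (x k) - taylorModel p f (x k) (s k))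
  successful : ∀ k, IsActive f ε x k → η < ρ k →
    x (k + 1) = x k + s k ∧ σreg (k + 1) = max (γ₂ * σ k) σmin
  unsuccessful : ∀ k, IsActive f ε x k → ¬ η < ρ k →
    x (k + 1) = x k ∧ σreg (k + 1) = γ₁ * σ k

/-- The derivatives of orders `1, …, p` are bounded by `Λ_1, …, Λ_p` at all iterates that the run
produces (the terminal one included). -/
def ARpSoSRun.DerivativesBounded {n p : ℕ} {f : EuclideanSpace ℝ (Fin n) → ℝ}
    {ε δ η γ₁ γ₂ σmin : ℝ} (r : ARpSoSRun p f ε δ η γ₁ γ₂ σmin) (Λ : ℕ → ℝ) : Prop :=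
  ∀ k, (∀ j < k, IsActive f ε r.x j) →
    ∀ j, 1 ≤ j → j ≤ p → ‖iteratedFDeriv ℝ j f (r.x k)‖ ≤ Λ j

/-! Write `p' = 2 d + 2`, so that `p` is `2 d` or `2 d + 1`, let `t = ‖s_k‖`, and let `μ` be the
shift. The minimizer `s_k` is a stationary point of the model, so the derivative of the Taylor
polynomial at `s_k` equals `-(μ + σ t ^ (2 d)) s_k`. Taylor's theorem for `∇f` then gives `‖∇f(x_k +
s_k)‖ ≤ L t ^ p + μ t + σ t ^ (2 d + 1)`. In Case 1, `μ = 0` and the bound on `t` follows at once.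
In Case 3, `μ = δ`. In Case 2, stationarity is instead compared with `∇f(x_k)`, which has norm above
`ε` because the iteration is carried out; there `μ` is bounded by a constant.

Cases 2 and 3 also need control of `σ_k`, namely `σ_k δ ^ (2 d - 1) ≤ M` with `M` independent of the
run (`exists_forall_σ_mul_le`). As long as `t ≤ δ`, this gives `σ t ^ (2 d + 1) ≤ M t ^ 2`, and `ε ≤
δ ^ 2` (from `a ≤ 1 / 2`) makes every term a small multiple of `ε` when `t` is too small.

The bound on `σ_k` has two sources. For `σ̄_k`, there is an explicit sum-of-squares certificate
(`exists_forall_isSoSMatrix`): after rescaling the variables by `θ ∼ δ`, the Hessian of the terms of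
degree at least 3 is dominated by a diagonal `O(θ) (1 + ‖X / θ‖ ^ (2 d))`. The margin `δ` of the
shifted Hessian absorbs the constant part, and the regularizer absorbs the rest once `σ` is of order
`δ ^ (1 - 2 d)`. For `σʳ_k`, an iteration with `σ_k δ` above a constant is successful
(`exists_forall_lt_ratio`), so the increase by `γ₁` occurs only below that constant. -/

/-! ### Taylor expansion of vector-valued maps with a Lipschitz top derivative -/

section Taylor

variable {E F : Type} [NormedAddCommGroup E] [NormedSpace ℝ E]
  [NormedAddCommGroup F] [NormedSpace ℝ F]

/-- The Taylor polynomial of order `k` of a vector-valued function. -/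
noncomputable def vectorTaylor (k : ℕ) (g : E → F) (x s : E) : F :=
  ∑ j ∈ Finset.range (k + 1), (1 / (j.factorial : ℝ)) • iteratedFDeriv ℝ j g x (fun _ => s)

theorem iteratedFDeriv_const_apply_succ (j : ℕ) (g : E → F) (x s : E) :
    iteratedFDeriv ℝ (j + 1) g x (fun _ => s) =
      iteratedFDeriv ℝ j (fderiv ℝ g) x (fun _ => s) s := by
  rw [iteratedFDeriv_succ_apply_right]
  rfl

/-- Evaluation at `(v, w)` is continuous and linear, so it commutes with the outer derivatives; what
remains is the symmetry of the second derivative. -/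
theorem iteratedFDeriv_fderiv_fderiv_comm {j : ℕ} {g : E → F} (hg : ContDiff ℝ (j + 2 : ℕ) g)
    (x v w : E) (m : Fin j → E) :
    iteratedFDeriv ℝ j (fderiv ℝ (fderiv ℝ g)) x m v w =
      iteratedFDeriv ℝ j (fderiv ℝ (fderiv ℝ g)) x m w v := by
  have h1 : ContDiff ℝ (j + 1 : ℕ) (fderiv ℝ g) := hg.fderiv_right (by norm_cast)
  have h2 : ContDiff ℝ (j : ℕ) (fderiv ℝ (fderiv ℝ g)) := h1.fderiv_right (by norm_cast)
  have key : ∀ v w : E, iteratedFDeriv ℝ j (fderiv ℝ (fderiv ℝ g)) x m v w =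
      iteratedFDeriv ℝ j (fun y => fderiv ℝ (fderiv ℝ g) y v w) x m := by
    intro v w
    let ev : (E →L[ℝ] E →L[ℝ] F) →L[ℝ] F :=
      (ContinuousLinearMap.apply ℝ F w).comp (ContinuousLinearMap.apply ℝ (E →L[ℝ] F) v)
    have := ev.iteratedFDeriv_comp_left (x := x) h2.contDiffAt (i := j) le_rfl
    have h3 : (ev ∘ fderiv ℝ (fderiv ℝ g)) = fun y => fderiv ℝ (fderiv ℝ g) y v w := by
      ext y; simp [ev]
    rw [h3] at this
    rw [this]
    simp [ev]
  rw [key, key]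
  congr 2
  ext y
  exact (hg.contDiffAt.isSymmSndFDerivAt (by simp)) v w

/-- Full symmetry of the iterated derivative is not needed: peel off the last slot, move `v` by
induction inside `fderiv ℝ g`, and exchange it with the last `s`. -/
theorem iteratedFDeriv_update_const {j : ℕ} {g : E → F} (hg : ContDiff ℝ (j + 1 : ℕ) g)
    (x s v : E) (i : Fin (j + 1)) :
    iteratedFDeriv ℝ (j + 1) g x (Function.update (fun _ => s) i v) =
      iteratedFDeriv ℝ j (fderiv ℝ g) x (fun _ => s) v := by
  induction j generalizing F with
  | zero =>
    rw [iteratedFDeriv_succ_apply_right]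
    have : i = 0 := Fin.fin_one_eq_zero i
    subst this
    congr 1
  | succ j ih =>
    rw [iteratedFDeriv_succ_apply_right]
    induction i using Fin.lastCases with
    | last =>
      simp only [Function.update_self]
      congr 2
      ext l
      simp [Fin.init]
    | cast i =>
      have h1 : Fin.init (Function.update (fun _ : Fin (j + 1 + 1) => s) i.castSucc v) =
          Function.update (fun _ => s) i v := by
        rw [Fin.init_update_castSucc]; rfl
      rw [h1, Function.update_of_ne (Fin.castSucc_lt_last i).ne',
        ih (hg.fderiv_right (by norm_cast)), iteratedFDeriv_const_apply_succ,
        iteratedFDeriv_fderiv_fderiv_comm (by exact_mod_cast hg)]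

theorem hasFDerivAt_iteratedFDeriv_const {j : ℕ} {g : E → F} (hg : ContDiff ℝ (j + 1 : ℕ) g)
    (x s : E) :
    HasFDerivAt (fun s => iteratedFDeriv ℝ (j + 1) g x (fun _ => s))
      (((j + 1 : ℕ) : ℝ) • iteratedFDeriv ℝ j (fderiv ℝ g) x (fun _ => s)) s := by
  have h := HasFDerivAt.multilinear_comp (iteratedFDeriv ℝ (j + 1) g x)
    (g := fun (_ : Fin (j + 1)) (y : E) => y) (g' := fun _ => ContinuousLinearMap.id ℝ E) (x := s)
    (fun i => hasFDerivAt_id s)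
  convert h using 1
  ext v
  simp [iteratedFDeriv_update_const hg, Nat.cast_smul_eq_nsmul, add_smul]

/-- Differentiation in the step lowers the Taylor order and replaces `g` by its derivative. This
drives both the remainder estimate and the stationarity condition. -/
theorem hasFDerivAt_vectorTaylor {k : ℕ} {g : E → F} (hg : ContDiff ℝ (k + 1 : ℕ) g) (x s : E) :
    HasFDerivAt (vectorTaylor (k + 1) g x) (vectorTaylor k (fderiv ℝ g) x s) s := by
  have h : HasFDerivAt (fun s => ∑ j ∈ Finset.range (k + 1), (1 / ((j + 1).factorial : ℝ)) •
      iteratedFDeriv ℝ (j + 1) g x (fun _ => s)) (vectorTaylor k (fderiv ℝ g) x s) s := by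
    unfold vectorTaylor
    refine HasFDerivAt.fun_sum fun j hj => ?_
    have h1 := (hasFDerivAt_iteratedFDeriv_const (j := j) (hg.of_le (by
      have := Finset.mem_range.1 hj
      exact_mod_cast this)) x s).const_smul (1 / ((j + 1).factorial : ℝ))
    have h2 : (1 / (j.factorial : ℝ)) = 1 / ((j + 1).factorial : ℝ) * ((j + 1 : ℕ) : ℝ) := by
      rw [Nat.factorial_succ]
      push_cast
      field_simp
    rw [h2, mul_smul]
    exact h1
  have h2 : vectorTaylor (k + 1) g x = fun s => (∑ j ∈ Finset.range (k + 1),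
      (1 / ((j + 1).factorial : ℝ)) • iteratedFDeriv ℝ (j + 1) g x (fun _ => s)) + g x := by
    ext s
    rw [vectorTaylor, Finset.sum_range_succ']
    simp
  rw [h2]
  exact h.add_const _

theorem norm_iteratedFDeriv_fderiv_sub (k : ℕ) (g : E → F) (x y : E) :
    ‖iteratedFDeriv ℝ k (fderiv ℝ g) x - iteratedFDeriv ℝ k (fderiv ℝ g) y‖ =
      ‖iteratedFDeriv ℝ (k + 1) g x - iteratedFDeriv ℝ (k + 1) g y‖ := by
  simp only [iteratedFDeriv_succ_eq_comp_right, Function.comp_apply]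
  rw [← dist_eq_norm, ← dist_eq_norm]
  exact ((continuousMultilinearCurryRightEquiv' ℝ k E F).symm.dist_map _ _).symm

/-- Taylor's theorem for functions with a Lipschitz `k`th derivative. -/
theorem norm_sub_vectorTaylor_le {k : ℕ} {g : E → F} (hg : ContDiff ℝ k g) {M : ℝ} {x : E}
    (hM : ∀ y, ‖iteratedFDeriv ℝ k g y - iteratedFDeriv ℝ k g x‖ ≤ M * ‖y - x‖) :
    ∀ s : E, ‖g (x + s) - vectorTaylor k g x s‖ ≤ M * ‖s‖ ^ (k + 1) / (k + 1).factorial := by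
  -- The induction hypothesis is applied to `fderiv ℝ g`, whose codomain differs from that of `g`.
  induction k generalizing F with
  | zero =>
    intro s
    have h := hM (x + s)
    rw [iteratedFDeriv_zero_eq_comp, Function.comp_apply, Function.comp_apply, ← map_sub,
      LinearIsometryEquiv.norm_map] at h
    simpa [vectorTaylor] using h
  | succ k ih =>
    intro s
    have hg' : ContDiff ℝ k (fderiv ℝ g) := hg.fderiv_right (by norm_cast)
    have ih' := ih hg' (fun y => by rw [norm_iteratedFDeriv_fderiv_sub]; exact hM y)
    have hd : ∀ t : ℝ, HasDerivAt (fun t : ℝ => g (x + t • s) - vectorTaylor (k + 1) g x (t • s))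
        ((fderiv ℝ g (x + t • s) - vectorTaylor k (fderiv ℝ g) x (t • s)) s) t := by
      intro t
      have h1 : HasFDerivAt (fun y => g (x + y)) (fderiv ℝ g (x + t • s)) (t • s) := by
        have := (hg.differentiable (by simp)).differentiableAt (x := x + t • s) |>.hasFDerivAt
        exact this.comp (t • s) ((hasFDerivAt_id (t • s)).const_add x)
      have h2 := h1.sub (hasFDerivAt_vectorTaylor hg x (t • s))
      have h3 : HasDerivAt (fun t : ℝ => t • s) s t := by
        simpa using (hasDerivAt_id t).smul_const s
      exact h2.comp_hasDerivAt t h3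
    have hB : ∀ t : ℝ, HasDerivAt
        (fun t : ℝ => t ^ (k + 2) * (M * ‖s‖ ^ (k + 2) / (k + 2).factorial))
        (t ^ (k + 1) * (M * ‖s‖ ^ (k + 2) / (k + 1).factorial)) t := by
      intro t
      have h1 := (hasDerivAt_pow (k + 2) t).mul_const (M * ‖s‖ ^ (k + 2) / (k + 2).factorial)
      have h2 : ((k + 2 : ℕ) : ℝ) * t ^ (k + 2 - 1) * (M * ‖s‖ ^ (k + 2) / (k + 2).factorial) =
          t ^ (k + 1) * (M * ‖s‖ ^ (k + 2) / (k + 1).factorial) := by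
        rw [Nat.factorial_succ (k + 1), show k + 2 - 1 = k + 1 by omega]
        push_cast
        have : ((k : ℝ) + 1 + 1) ≠ 0 := by positivity
        field_simp
        ring
      rwa [h2] at h1
    have := image_norm_le_of_norm_deriv_right_le_deriv_boundary
      (a := 0) (b := 1) (f := fun t : ℝ => g (x + t • s) - vectorTaylor (k + 1) g x (t • s))
      (fun t _ => (hd t).continuousAt.continuousWithinAt) (fun t _ => (hd t).hasDerivWithinAt)
      (by simp [vectorTaylor, Finset.sum_range_succ', iteratedFDeriv_const_apply_succ]) hB
      (fun t ht => ?_) (Set.right_mem_Icc.2 zero_le_one)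
    · simpa using this
    · refine (ContinuousLinearMap.le_opNorm _ _).trans ?_
      calc _ ≤ M * ‖t • s‖ ^ (k + 1) / (k + 1).factorial * ‖s‖ := by
            gcongr; exact ih' _
        _ = _ := by
            rw [norm_smul, Real.norm_of_nonneg ht.1]
            ring

end Taylor

/-! ### Sums of squares and SoS-matrices -/

section SumOfSquares

theorem IsSumSq.pow_of_commRing {R : Type*} [CommRing R] {u : R} (hu : IsSumSq u) (k : ℕ) :
    IsSumSq (u ^ k) := by
  simpa using IsSumSq.prod (I := Finset.range k) (x := fun _ => u) fun _ _ => hu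

theorem IsSumSq.one_add_pow_sub_pow {R : Type*} [CommRing R] {u : R} (hu : IsSumSq u) {l d : ℕ}
    (h : l ≤ d) : IsSumSq (1 + u ^ d - u ^ l) := by
  have hp := hu.pow_of_commRing
  -- This is `(1 - u ^ l) (1 - u ^ (d - l)) + u ^ (d - l)`, with a factor `1 - u` taken out of each
  -- bracket.
  have h1 : 1 + u ^ d - u ^ l = ((1 - u) * (1 - u)) *
      ((∑ i ∈ Finset.range l, u ^ i) * ∑ i ∈ Finset.range (d - l), u ^ i) + u ^ (d - l) := by
    have e1 := mul_neg_geom_sum u l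
    have e2 := mul_neg_geom_sum u (d - l)
    have e3 : u ^ d = u ^ l * u ^ (d - l) := by rw [← pow_add]; congr 1; omega
    rw [e3]
    linear_combination (-1 + u ^ (d - l)) * e1 -
      ((1 - u) * ∑ i ∈ Finset.range l, u ^ i) * e2
  rw [h1]
  exact ((IsSumSq.mul_self _).mul
    ((IsSumSq.sum fun i _ => hp i).mul (IsSumSq.sum fun i _ => hp i))).add (hp _)

/-- A certified form of `∏ Y_i ^ 2 ≤ ‖Y‖ ^ (2 k)`: replace one factor `Y a ^ 2` at a time by the
full sum of squares. -/
theorem isSumSq_sum_sq_pow_length_sub {R ι : Type*} [CommRing R] [Fintype ι] (Y : ι → R)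
    (κ : List ι) : IsSumSq ((∑ i, Y i ^ 2) ^ κ.length - (κ.map Y).prod ^ 2) := by
  classical
  induction κ with
  | nil => simp
  | cons a κ ih =>
    have h1 : (∑ i, Y i ^ 2) = Y a ^ 2 + ∑ i ∈ Finset.univ.erase a, Y i ^ 2 :=
      (Finset.add_sum_erase _ _ (Finset.mem_univ a)).symm
    have h2 : (∑ i, Y i ^ 2) ^ (a :: κ).length - ((a :: κ).map Y).prod ^ 2 =
        (∑ i, Y i ^ 2) * ((∑ i, Y i ^ 2) ^ κ.length - (κ.map Y).prod ^ 2) +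
          (∑ i ∈ Finset.univ.erase a, Y i ^ 2) * ((κ.map Y).prod * (κ.map Y).prod) := by
      simp only [List.length_cons, List.map_cons, List.prod_cons]
      linear_combination (κ.map Y).prod ^ 2 * h1
    rw [h2]
    exact ((IsSumSq.sum_sq _ _).mul ih).add ((IsSumSq.sum_sq _ _).mul (IsSumSq.mul_self _))

theorem isSumSq_one_add_sub_list_prod {R ι : Type*} [CommRing R] [Fintype ι] (Y : ι → R)
    {κ : List ι} {d : ℕ} (h : κ.length ≤ d) :
    IsSumSq (1 + (∑ i, Y i ^ 2) ^ d - (κ.map Y).prod ^ 2) := by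
  have := ((IsSumSq.sum_sq Finset.univ Y).one_add_pow_sub_pow h).add
    (isSumSq_sum_sq_pow_length_sub Y κ)
  rwa [sub_add_sub_cancel] at this

theorem MvPolynomial.isSumSq_C {σ : Type*} {c : ℝ} (hc : 0 ≤ c) :
    IsSumSq (C c : MvPolynomial σ ℝ) := by
  rw [← Real.mul_self_sqrt hc, C_mul]
  exact IsSumSq.mul_self _

variable {n : ℕ}

local notation "Poly" => MvPolynomial (Fin n) ℝ

theorem isSoSMatrix_transpose_mul_self {ι : Type*} [Fintype ι] (V : Matrix ι (Fin n) Poly) :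
    IsSoSMatrix (V.transpose * V) := by
  refine ⟨Fintype.card ι, V.submatrix (Fintype.equivFin ι).symm id, ?_⟩
  ext i j : 1
  simp only [Matrix.mul_apply, Matrix.transpose_apply, Matrix.submatrix_apply, id]
  exact ((Fintype.equivFin ι).symm.sum_comp fun k => V k i * V k j).symm

theorem IsSoSMatrix.add {A B : Matrix (Fin n) (Fin n) Poly} (hA : IsSoSMatrix A)
    (hB : IsSoSMatrix B) : IsSoSMatrix (A + B) := by
  obtain ⟨m, V, rfl⟩ := hA
  obtain ⟨m', W, rfl⟩ := hB
  have := isSoSMatrix_transpose_mul_self (Matrix.fromRows V W)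
  rwa [Matrix.transpose_fromRows, Matrix.fromCols_mul_fromRows] at this

theorem isSoSMatrix_zero : IsSoSMatrix (0 : Matrix (Fin n) (Fin n) Poly) :=
  ⟨0, 0, by simp⟩

theorem IsSoSMatrix.sum {ι : Type*} {I : Finset ι} {A : ι → Matrix (Fin n) (Fin n) Poly}
    (h : ∀ i ∈ I, IsSoSMatrix (A i)) : IsSoSMatrix (∑ i ∈ I, A i) :=
  Finset.sum_induction A IsSoSMatrix (fun _ _ => IsSoSMatrix.add) isSoSMatrix_zero h

theorem IsSoSMatrix.smul {g : Poly} (hg : IsSumSq g) {A : Matrix (Fin n) (Fin n) Poly}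
    (hA : IsSoSMatrix A) : IsSoSMatrix (g • A) := by
  induction hg using IsSumSq.rec' with
  | zero => simpa using isSoSMatrix_zero
  | @sq_add x s hx hs ih =>
    rw [add_smul]
    refine IsSoSMatrix.add ?_ ih
    obtain ⟨r, rfl⟩ := hx
    obtain ⟨m, V, rfl⟩ := hA
    refine ⟨m, r • V, ?_⟩
    rw [Matrix.transpose_smul, Matrix.smul_mul, Matrix.mul_smul, smul_smul]

theorem isSoSMatrix_vecMulVec (v : Fin n → Poly) : IsSoSMatrix (Matrix.vecMulVec v v) := by
  refine ⟨1, Matrix.of fun _ => v, ?_⟩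
  ext i j : 1
  simp [Matrix.mul_apply, Matrix.vecMulVec_apply]

theorem isSoSMatrix_single {g : Poly} (hg : IsSumSq g) (a : Fin n) :
    IsSoSMatrix (Matrix.single a a g) := by
  have := (isSoSMatrix_vecMulVec (Pi.single a (1 : Poly))).smul hg
  rwa [← Matrix.single_eq_single_vecMulVec_single, Matrix.smul_single, smul_eq_mul, mul_one] at this

theorem isSoSMatrix_diagonal {g : Fin n → Poly} (hg : ∀ i, IsSumSq (g i)) :
    IsSoSMatrix (Matrix.diagonal g) := by
  rw [← Matrix.sum_single_eq_diagonal]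
  exact IsSoSMatrix.sum fun i _ => isSoSMatrix_single (hg i) i

theorem isSoSMatrix_map_C {A : Matrix (Fin n) (Fin n) ℝ} (hA : A.PosSemidef) :
    IsSoSMatrix (A.map (MvPolynomial.C : ℝ → Poly)) := by
  obtain ⟨m, v, rfl⟩ := Matrix.posSemidef_iff_eq_sum_vecMulVec.1 hA
  have h : (∑ i, Matrix.vecMulVec (v i) (star (v i))).map (MvPolynomial.C : ℝ → Poly) =
      ∑ i, Matrix.vecMulVec (fun j => MvPolynomial.C (v i j)) (fun j => MvPolynomial.C (v i j)) := by
    ext i j : 1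
    simp [Matrix.sum_apply, Matrix.vecMulVec_apply]
  rw [h]
  exact IsSoSMatrix.sum fun i _ => isSoSMatrix_vecMulVec _

theorem vecMulVec_single_single (i j : Fin n) (x y : Poly) :
    Matrix.vecMulVec (Pi.single i x) (Pi.single j y) = Matrix.single i j (x * y) := by
  ext k l : 1
  rw [Matrix.vecMulVec_apply]
  by_cases h1 : i = k
  · subst h1
    by_cases h2 : j = l
    · subst h2
      rw [Pi.single_eq_same, Pi.single_eq_same, Matrix.single_apply_same]
    · rw [Matrix.single_apply_of_col_ne _ _ h2, Pi.single_eq_of_ne (Ne.symm h2), mul_zero]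
  · rw [Matrix.single_apply_of_row_ne h1, Pi.single_eq_of_ne (Ne.symm h1), zero_mul]

/-- Complete the square: with `v = M₁ e_a ± M₂ e_b`, the matrix `|e| v vᵀ` has the wanted
off-diagonal entries, and its diagonal entries `|e| M₁ ^ 2`, `|e| M₂ ^ 2` lie below `E g` by sums of
squares. -/
theorem isSoSMatrix_single_mul_add_single_mul {g M₁ M₂ : Poly} (hg : IsSumSq g)
    (h1 : IsSumSq (g - M₁ ^ 2)) (h2 : IsSumSq (g - M₂ ^ 2)) {e E : ℝ} (he : |e| ≤ E)
    (a b : Fin n) :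
    IsSoSMatrix (Matrix.single a b (MvPolynomial.C e * (M₁ * M₂)) +
      Matrix.single b a (MvPolynomial.C e * (M₁ * M₂)) +
      (Matrix.single a a (MvPolynomial.C E * g) + Matrix.single b b (MvPolynomial.C E * g))) := by
  have h3 : IsSumSq (MvPolynomial.C (E - |e|) : Poly) := MvPolynomial.isSumSq_C (by linarith)
  have h4 : IsSumSq (MvPolynomial.C |e| : Poly) := MvPolynomial.isSumSq_C (abs_nonneg e)
  -- `t` is a sign of `e`, taken to be `1` when `e = 0`.
  obtain ⟨t, hs, hs2⟩ : ∃ t : ℝ, |e| * t = e ∧ |e| * t ^ 2 = |e| := by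
    rcases le_total 0 e with h | h
    · exact ⟨1, by simp [abs_of_nonneg h], by simp⟩
    · exact ⟨-1, by simp [abs_of_nonpos h], by simp⟩
  have hC1 : (MvPolynomial.C |e| * MvPolynomial.C t : Poly) = MvPolynomial.C e := by
    rw [← MvPolynomial.C_mul, hs]
  have hC2 : (MvPolynomial.C |e| * MvPolynomial.C t ^ 2 : Poly) = MvPolynomial.C |e| := by
    rw [← MvPolynomial.C_pow, ← MvPolynomial.C_mul, hs2]
  have hE : (MvPolynomial.C E : Poly) = MvPolynomial.C (E - |e|) + MvPolynomial.C |e| := by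
    rw [← MvPolynomial.C_add, sub_add_cancel]
  generalize (MvPolynomial.C E : Poly) = cE at *
  generalize (MvPolynomial.C (E - |e|) : Poly) = c1 at *
  generalize (MvPolynomial.C |e| : Poly) = c2 at *
  generalize (MvPolynomial.C e : Poly) = c3 at *
  generalize (MvPolynomial.C t : Poly) = c4 at *
  have hv := (isSoSMatrix_vecMulVec (Pi.single a M₁ + Pi.single b (c4 * M₂))).smul h4
  have ha := isSoSMatrix_single ((h3.mul hg).add (h4.mul h1)) a
  have hb := isSoSMatrix_single ((h3.mul hg).add (h4.mul h2)) b
  have h := hv.add (ha.add hb)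
  rw [Matrix.add_vecMulVec, Matrix.vecMulVec_add, Matrix.vecMulVec_add, vecMulVec_single_single,
    vecMulVec_single_single, vecMulVec_single_single, vecMulVec_single_single, smul_add, smul_add,
    smul_add, Matrix.smul_single, Matrix.smul_single, Matrix.smul_single, Matrix.smul_single,
    smul_eq_mul, smul_eq_mul, smul_eq_mul, smul_eq_mul] at h
  have e1 : c2 * (M₁ * (c4 * M₂)) = c3 * (M₁ * M₂) := by linear_combination (M₁ * M₂) * hC1
  have e2 : c2 * (c4 * M₂ * M₁) = c3 * (M₁ * M₂) := by linear_combination (M₁ * M₂) * hC1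
  have e4 : cE * g = c2 * (M₁ * M₁) + (c1 * g + c2 * (g - M₁ ^ 2)) := by rw [hE]; ring
  have e5 : cE * g = c2 * (c4 * M₂ * (c4 * M₂)) + (c1 * g + c2 * (g - M₂ ^ 2)) := by
    linear_combination g * hE - M₂ ^ 2 * hC2
  rw [e1, e2] at h
  have h5 := congrArg (Matrix.single a a) e4
  have h6 := congrArg (Matrix.single b b) e5
  rw [Matrix.single_add] at h5 h6
  rw [h5, h6]
  convert h using 1
  abel

/-- An off-diagonal monomial of degree at most `2 d` is dominated by the diagonal. -/
theorem isSoSMatrix_single_add_single (Y : Fin n → Poly) {d : ℕ} {κ : List (Fin n)}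
    (hκ : κ.length ≤ 2 * d) {e E : ℝ} (he : |e| ≤ E) (a b : Fin n) :
    IsSoSMatrix (Matrix.single a b (MvPolynomial.C e * (κ.map Y).prod) +
      Matrix.single b a (MvPolynomial.C e * (κ.map Y).prod) +
      (Matrix.single a a (MvPolynomial.C E * (1 + (∑ i, Y i ^ 2) ^ d)) +
        Matrix.single b b (MvPolynomial.C E * (1 + (∑ i, Y i ^ 2) ^ d)))) := by
  -- Split the monomial into two halves of degree at most `d`, so that the square of each lies below
  -- `1 + ‖Y‖ ^ (2 d)`.
  have hM : (κ.map Y).prod = ((κ.take d).map Y).prod * ((κ.drop d).map Y).prod := by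
    rw [← List.prod_append, ← List.map_append, List.take_append_drop]
  rw [hM]
  refine isSoSMatrix_single_mul_add_single_mul
    (IsSumSq.one.add ((IsSumSq.sum_sq _ _).pow_of_commRing d))
    (isSumSq_one_add_sub_list_prod Y ?_) (isSumSq_one_add_sub_list_prod Y ?_) he a b
  · simp
  · rw [List.length_drop]; omega

/-- A symmetric polynomial matrix whose entries are small monomials of degree at most `2 d` is
dominated by the diagonal. -/
theorem isSoSMatrix_add_diagonal (Y : Fin n → Poly) {d : ℕ} {E : ℝ}
    {H : Matrix (Fin n) (Fin n) Poly} (hs : ∀ a b, H b a = H a b)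
    (hH : ∀ a b, ∃ (e : ℝ) (κ : List (Fin n)), |e| ≤ E ∧ κ.length ≤ 2 * d ∧
      H a b = MvPolynomial.C e * (κ.map Y).prod) :
    IsSoSMatrix (H + Matrix.diagonal fun _ =>
      MvPolynomial.C (n * E) * (1 + (∑ i, Y i ^ 2) ^ d)) := by
  set G : Poly := MvPolynomial.C E * (1 + (∑ i, Y i ^ 2) ^ d) with hG
  have h1 : IsSoSMatrix (∑ a, ∑ b, (Matrix.single a b (H a b) + Matrix.single b a (H a b) +
      (Matrix.single a a G + Matrix.single b b G))) := by
    refine IsSoSMatrix.sum fun a _ => IsSoSMatrix.sum fun b _ => ?_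
    obtain ⟨e, κ, he, hκ, h⟩ := hH a b
    rw [h]
    exact isSoSMatrix_single_add_single Y hκ he a b
  have h2 : ∑ a, ∑ b, Matrix.single b a (H a b) = H := by
    rw [Finset.sum_comm]
    simp_rw [fun a b => (hs a b).symm]
    exact (Matrix.matrix_eq_sum_single H).symm
  have h3 : (Matrix.diagonal fun _ : Fin n =>
      MvPolynomial.C (n * E) * (1 + (∑ i, Y i ^ 2) ^ d)) = n • ∑ a : Fin n, Matrix.single a a G := by
    rw [Matrix.sum_single_eq_diagonal, ← Matrix.diagonal_smul]
    congr 1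
    ext1 i
    simp [hG, mul_assoc]
  -- The sum over ordered pairs counts `H` twice, and each diagonal position receives `2 n` copies
  -- of `G`; hence the factor `1 / 2`.
  have h4 : (H + Matrix.diagonal fun _ =>
      MvPolynomial.C (n * E) * (1 + (∑ i, Y i ^ 2) ^ d)) = (MvPolynomial.C (1 / 2) : Poly) •
      ∑ a, ∑ b, (Matrix.single a b (H a b) + Matrix.single b a (H a b) +
        (Matrix.single a a G + Matrix.single b b G)) := by
    simp only [Finset.sum_add_distrib, h2, ← Matrix.matrix_eq_sum_single, h3, Finset.sum_const,
      Finset.card_univ, Fintype.card_fin, ← Finset.smul_sum]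
    rw [← two_smul Poly H, ← two_smul Poly (n • _), ← smul_add, smul_smul]
    have : (MvPolynomial.C (1 / 2) * 2 : Poly) = 1 := by
      rw [show (2 : Poly) = MvPolynomial.C 2 from rfl, ← MvPolynomial.C_mul]
      norm_num
    rw [this, one_smul]
  rw [h4]
  exact h1.smul (MvPolynomial.isSumSq_C (by norm_num))

/-- A list of variables, unlike an exponent vector, is easily cut in two. In the rescaled variables
`X / θ` the coefficient gains a factor `θ` per degree, which is the source of smallness. -/
theorem exists_list_monomial_eq (β : Fin n →₀ ℕ) :
    ∃ κ : List (Fin n), κ.length = β.degree ∧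
      ∀ (c θ : ℝ), θ ≠ 0 → (MvPolynomial.monomial β c : Poly) =
        MvPolynomial.C (c * θ ^ β.degree) *
          (κ.map fun i => MvPolynomial.C θ⁻¹ * MvPolynomial.X i).prod := by
  suffices ∃ κ : List (Fin n), κ.length = β.degree ∧
      (κ.map fun i => (MvPolynomial.X i : Poly)).prod = MvPolynomial.monomial β 1 by
    obtain ⟨κ, h1, h2⟩ := this
    refine ⟨κ, h1, fun c θ hθ => ?_⟩
    have h3 : (κ.map fun i => (MvPolynomial.C θ⁻¹ * MvPolynomial.X i : Poly)).prod =
        MvPolynomial.C (θ⁻¹ ^ κ.length) * (κ.map fun i => (MvPolynomial.X i : Poly)).prod := by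
      rw [List.prod_map_mul]
      simp only [List.map_const', List.prod_replicate, MvPolynomial.C_pow]
    rw [h3, h2, ← mul_assoc, ← MvPolynomial.C_mul, h1, inv_pow, mul_assoc,
      mul_inv_cancel₀ (pow_ne_zero _ hθ), mul_one, MvPolynomial.C_mul_monomial, mul_one]
  induction β using Finsupp.induction_linear with
  | zero => exact ⟨[], by simp, by simp⟩
  | add β γ h h' =>
    obtain ⟨κ, h1, h2⟩ := h
    obtain ⟨κ', h1', h2'⟩ := h'
    exact ⟨κ ++ κ', by simp [h1, h1'], by simp [h2, h2']⟩
  | single i m =>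
    exact ⟨List.replicate m i, by simp, by simp [MvPolynomial.X_pow_eq_monomial]⟩

end SumOfSquares

/-! ### Hessians of monomials and of powers of the squared norm -/

section PolynomialHessian

variable {n : ℕ}

local notation "Poly" => MvPolynomial (Fin n) ℝ

theorem polyHessian_add (q r : Poly) : polyHessian (q + r) = polyHessian q + polyHessian r := by
  ext i j : 1
  simp [polyHessian]

theorem polyHessian_sum {ι : Type*} (I : Finset ι) (q : ι → Poly) :
    polyHessian (∑ i ∈ I, q i) = ∑ i ∈ I, polyHessian (q i) := by
  ext i j : 1
  simp [polyHessian, Matrix.sum_apply]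

theorem polyHessian_C_mul (c : ℝ) (q : Poly) :
    polyHessian (MvPolynomial.C c * q) = (MvPolynomial.C c : Poly) • polyHessian q := by
  ext i j : 1
  simp [polyHessian]

theorem pderiv_pderiv_monomial (α : Fin n →₀ ℕ) (c : ℝ) (a b : Fin n) :
    MvPolynomial.pderiv a (MvPolynomial.pderiv b (MvPolynomial.monomial α c : Poly)) = 0 ∨
    ∃ (β : Fin n →₀ ℕ) (w : ℕ), β.degree + 2 = α.degree ∧ w ≤ α.degree ^ 2 ∧
      MvPolynomial.pderiv a (MvPolynomial.pderiv b (MvPolynomial.monomial α c : Poly)) =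
        MvPolynomial.monomial β (c * w) := by
  rw [MvPolynomial.pderiv_monomial, MvPolynomial.pderiv_monomial]
  by_cases hb : α b = 0
  · left; simp [hb]
  by_cases ha : (α - Finsupp.single b 1 : Fin n →₀ ℕ) a = 0
  · left; rw [ha]; simp
  right
  have key : ∀ (γ : Fin n →₀ ℕ) (i : Fin n), γ i ≠ 0 →
      (γ - Finsupp.single i 1).degree + 1 = γ.degree := by
    intro γ i hi
    have h := Finsupp.sub_add_single_one_cancel hi
    conv_rhs => rw [← h]
    simp
  have h1 := key _ _ hb
  have h2 := key _ _ ha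
  have h3 := Finsupp.le_degree b α
  have h4 := Finsupp.le_degree a (α - Finsupp.single b 1)
  refine ⟨α - Finsupp.single b 1 - Finsupp.single a 1, α b * (α - Finsupp.single b 1 : Fin n →₀ ℕ) a, by omega, ?_, ?_⟩
  · rw [sq]
    exact Nat.mul_le_mul h3 (h4.trans (by omega))
  · rw [mul_assoc]
    push_cast
    rfl

theorem polyHessian_monomial_of_degree_le_one {α : Fin n →₀ ℕ} (h : α.degree ≤ 1) (c : ℝ) :
    polyHessian (MvPolynomial.monomial α c : Poly) = 0 := by
  ext a b : 1
  rcases pderiv_pderiv_monomial α c a b with h0 | ⟨β, w, h1, -, -⟩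
  · simpa [polyHessian] using h0
  · omega

/-- Degree at least 3 leaves at least one variable after two derivatives, so rescaling yields at
least one factor `θ`; differentiation costs at most the degree squared. -/
theorem isSoSMatrix_polyHessian_monomial_add {d : ℕ} {α : Fin n →₀ ℕ} (h3 : 3 ≤ α.degree)
    (h : α.degree ≤ 2 * d + 2) {c B θ : ℝ} (hc : |c| ≤ B) (hθ : 0 < θ) (hθ1 : θ ≤ 1) :
    IsSoSMatrix (polyHessian (MvPolynomial.monomial α c : Poly) + Matrix.diagonal fun _ =>
      MvPolynomial.C (n * (B * (2 * d + 2) ^ 2 * θ)) *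
        (1 + (∑ i, (MvPolynomial.C θ⁻¹ * MvPolynomial.X i) ^ 2) ^ d)) := by
  have hB : 0 ≤ B := (abs_nonneg c).trans hc
  refine isSoSMatrix_add_diagonal _ (fun a b => ?_) (fun a b => ?_)
  · simp only [polyHessian, Matrix.of_apply]
    rw [MvPolynomial.pderiv_monomial, MvPolynomial.pderiv_monomial, MvPolynomial.pderiv_monomial,
      MvPolynomial.pderiv_monomial, tsub_right_comm]
    congr 1
    rcases eq_or_ne a b with rfl | hab
    · rfl
    · simp [hab, hab.symm]
      ring
  · rcases pderiv_pderiv_monomial α c a b with h0 | ⟨β, w, h1, h2, h4⟩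
    · exact ⟨0, [], by simpa using by positivity, by simp, by simpa [polyHessian] using h0⟩
    · obtain ⟨κ, hκ, hm⟩ := exists_list_monomial_eq β
      refine ⟨_, κ, ?_, by omega, h4.trans (hm _ θ hθ.ne')⟩
      rw [abs_mul, abs_mul, Nat.abs_cast, abs_of_pos (pow_pos hθ _)]
      have h5 : (w : ℝ) ≤ (2 * d + 2) ^ 2 := by
        have : w ≤ (2 * d + 2) ^ 2 := h2.trans (Nat.pow_le_pow_left h 2)
        exact_mod_cast this
      have h6 : θ ^ β.degree ≤ θ := pow_le_of_le_one hθ.le hθ1 (by omega)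
      gcongr

/-- The squared Euclidean norm as a polynomial. -/
noncomputable def normSqPoly (n : ℕ) : MvPolynomial (Fin n) ℝ := ∑ i, MvPolynomial.X i ^ 2

theorem pderiv_normSqPoly (i : Fin n) :
    MvPolynomial.pderiv i (normSqPoly n) = 2 * MvPolynomial.X i := by
  rw [normSqPoly, map_sum, Finset.sum_eq_single i]
  · simp
  · intro j _ hj
    simp [MvPolynomial.pderiv_X_of_ne hj]
  · simp

theorem polyHessian_normSqPoly :
    polyHessian (normSqPoly n) = Matrix.diagonal fun _ => 2 := by
  ext i j : 1
  have h2 : (2 : Poly) = MvPolynomial.C 2 := rfl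
  simp only [polyHessian, Matrix.of_apply, pderiv_normSqPoly]
  rw [h2, MvPolynomial.pderiv_C_mul, MvPolynomial.pderiv_X, Matrix.diagonal_apply, Pi.single_apply]
  by_cases h : i = j
  · simp [h]
  · simp [h, Ne.symm h]

/-- For `d = 0` the exponent `d - 1` truncates to `0`, but the coefficient of that term vanishes. -/
theorem polyHessian_normSqPoly_pow (d : ℕ) :
    polyHessian (normSqPoly n ^ (d + 1)) =
      (Matrix.diagonal fun _ => MvPolynomial.C (2 * ((d : ℝ) + 1)) * normSqPoly n ^ d) +
      (MvPolynomial.C (4 * ((d : ℝ) * (d + 1))) * normSqPoly n ^ (d - 1) : Poly) •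
        Matrix.vecMulVec MvPolynomial.X MvPolynomial.X := by
  ext i j : 1
  have h := congrFun (congrFun (polyHessian_normSqPoly (n := n)) i) j
  simp only [polyHessian, Matrix.of_apply] at h ⊢
  rw [MvPolynomial.pderiv_pow, MvPolynomial.pderiv_mul, h, Matrix.add_apply, Matrix.smul_apply,
    Matrix.vecMulVec_apply, Matrix.diagonal_apply, Matrix.diagonal_apply, MvPolynomial.pderiv_mul,
    MvPolynomial.pderiv_pow, pderiv_normSqPoly, pderiv_normSqPoly]
  have h0 : MvPolynomial.pderiv i (((d + 1 : ℕ)) : Poly) = 0 := by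
    rw [show ((d + 1 : ℕ) : Poly) = MvPolynomial.C ((d + 1 : ℕ) : ℝ) by simp]
    exact MvPolynomial.pderiv_C
  rw [h0]
  have h1 : (MvPolynomial.C (2 * ((d : ℝ) + 1)) : Poly) = 2 * (d + 1) := by
    simp only [map_mul, map_add, map_natCast, map_one]
    rfl
  have h2 : (MvPolynomial.C (4 * ((d : ℝ) * (d + 1))) : Poly) = 4 * (d * (d + 1)) := by
    simp only [map_mul, map_add, map_natCast, map_one]
    rfl
  rw [h1, h2]
  by_cases hij : i = j
  · subst hij; simp; ring
  · simp [hij]; ring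

theorem isSumSq_normSqPoly : IsSumSq (normSqPoly n) := IsSumSq.sum_sq _ _

/-- What is left beyond the diagonal is a sum-of-squares multiple of `X Xᵀ`. With `τ = σ / (2 d +
2)` the subtracted diagonal is `σ ‖X‖ ^ (2 d)`. -/
theorem isSoSMatrix_polyHessian_normSqPoly_pow_sub {τ : ℝ} (hτ : 0 ≤ τ) (d : ℕ) :
    IsSoSMatrix (polyHessian (MvPolynomial.C τ * normSqPoly n ^ (d + 1)) -
      Matrix.diagonal fun _ => MvPolynomial.C (2 * (d + 1) * τ) * normSqPoly n ^ d) := by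
  have h1 : (Matrix.diagonal fun _ : Fin n =>
      MvPolynomial.C (2 * (d + 1) * τ) * normSqPoly n ^ d) =
      (MvPolynomial.C τ : Poly) • Matrix.diagonal fun _ : Fin n =>
        MvPolynomial.C (2 * ((d : ℝ) + 1)) * normSqPoly n ^ d := by
    rw [← Matrix.diagonal_smul]
    congr 1
    ext1 i
    rw [Pi.smul_apply, smul_eq_mul, ← mul_assoc, ← MvPolynomial.C_mul]
    ring_nf
  rw [polyHessian_C_mul, polyHessian_normSqPoly_pow, smul_add, h1, add_sub_cancel_left]
  exact ((isSoSMatrix_vecMulVec _).smul ((MvPolynomial.isSumSq_C (by positivity)).mul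
    (isSumSq_normSqPoly.pow_of_commRing _))).smul (MvPolynomial.isSumSq_C hτ)

end PolynomialHessian

/-! ### SoS-convexity of a regularized polynomial -/

section TaylorPolynomial

variable {n : ℕ}

local notation "Poly" => MvPolynomial (Fin n) ℝ

/-- The exponent of the monomial `∏ l, X (κ l)`. -/
noncomputable def indexExponent {j : ℕ} (κ : Fin j → Fin n) : Fin n →₀ ℕ :=
  ∑ l, Finsupp.single (κ l) 1

theorem degree_indexExponent {j : ℕ} (κ : Fin j → Fin n) : (indexExponent κ).degree = j := by
  simp [indexExponent, map_sum]

/-- The polynomial with coefficients `c j κ` at `∏ l, X (κ l)`, for `j ≤ p`. -/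
noncomputable def tensorPolynomial (p : ℕ) (c : (j : ℕ) → (Fin j → Fin n) → ℝ) : Poly :=
  ∑ j ∈ Finset.range (p + 1), ∑ κ : Fin j → Fin n, MvPolynomial.monomial (indexExponent κ) (c j κ)

/-- The sum runs over ordered pairs, so `X a * X b` arises from both orders and the Hessian is the
symmetrized coefficient matrix. -/
theorem polyHessian_quadratic (c : (Fin 2 → Fin n) → ℝ) :
    polyHessian (∑ κ : Fin 2 → Fin n, (MvPolynomial.monomial (indexExponent κ) (c κ) : Poly)) =
      (Matrix.of fun a b => c ![a, b] + c ![b, a]).map MvPolynomial.C := by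
  have h1 : (∑ κ : Fin 2 → Fin n, (MvPolynomial.monomial (indexExponent κ) (c κ) : Poly)) =
      ∑ i, ∑ j, MvPolynomial.C (c ![i, j]) * (MvPolynomial.X i * MvPolynomial.X j) := by
    rw [← Fintype.sum_prod_type', ← (finTwoArrowEquiv (Fin n)).symm.sum_comp]
    refine Finset.sum_congr rfl fun x _ => ?_
    simp [indexExponent, Fin.sum_univ_two, finTwoArrowEquiv, MvPolynomial.X,
      MvPolynomial.monomial_mul, MvPolynomial.C_mul_monomial]
  ext a b : 1
  rw [h1]
  have key : ∀ (e : ℝ) (i j : Fin n), MvPolynomial.pderiv a (MvPolynomial.pderiv b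
      (MvPolynomial.C e * (MvPolynomial.X i * MvPolynomial.X j) : Poly)) =
      MvPolynomial.C e * (if i = b then if j = a then 1 else 0 else 0) +
        MvPolynomial.C e * (if i = a then if j = b then 1 else 0 else 0) := by
    intro e i j
    rw [MvPolynomial.pderiv_C_mul, MvPolynomial.pderiv_C_mul, MvPolynomial.pderiv_mul, map_add,
      MvPolynomial.pderiv_mul, MvPolynomial.pderiv_mul]
    have hX : ∀ k l : Fin n, MvPolynomial.pderiv k (MvPolynomial.X l : Poly) =
        if l = k then 1 else 0 := by
      intro k l
      rw [MvPolynomial.pderiv_X, Pi.single_apply]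
    have hX0 : ∀ k l m : Fin n,
        MvPolynomial.pderiv m (MvPolynomial.pderiv k (MvPolynomial.X l : Poly)) = 0 := by
      intro k l m
      rw [hX]
      split_ifs <;> simp
    rw [hX0, hX0, hX, hX, hX, hX]
    split_ifs <;> ring
  simp only [polyHessian, Matrix.of_apply, map_sum, Matrix.map_apply, map_add, key]
  simp [Finset.sum_add_distrib]
  ring

variable (n) in
/-- If the Hessian at the origin is at least `δ`, then the regularized Taylor polynomial is
SoS-convex as soon as the regularization parameter is of order `δ ^ (1 - 2 d)`. -/
theorem exists_forall_isSoSMatrix {d p : ℕ} (hd : 1 ≤ d) (hp2 : 2 ≤ p) (hp : p ≤ 2 * d + 2)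
    {B : ℝ} (hB : 0 ≤ B) :
    ∃ W : ℝ, 1 ≤ W ∧ ∀ (c : (j : ℕ) → (Fin j → Fin n) → ℝ) (μ δ σ : ℝ),
      (∀ j, 3 ≤ j → j ≤ p → ∀ κ, |c j κ| ≤ B) → 0 < δ → δ ≤ 1 →
      ((Matrix.of fun a b => c 2 ![a, b] + c 2 ![b, a]) +
        Matrix.diagonal fun _ => μ - δ).PosSemidef →
      W ≤ σ * δ ^ (2 * d - 1) →
      IsSoSMatrix (polyHessian (tensorPolynomial p c + MvPolynomial.C (μ / 2) * normSqPoly n +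
        MvPolynomial.C (σ / (2 * d + 2)) * normSqPoly n ^ (d + 1))) := by
  obtain ⟨K, hK⟩ : ∃ K : ℝ, K = n * (B * (2 * d + 2) ^ 2) := ⟨_, rfl⟩
  have hK0 : 0 ≤ K := by rw [hK]; positivity
  obtain ⟨N, hN⟩ : ∃ N : ℝ, N = ∑ j ∈ Finset.range (p + 1), ∑ κ : Fin j → Fin n, (1 : ℝ) :=
    ⟨_, rfl⟩
  have hN0 : 0 ≤ N := by
    rw [hN]
    exact Finset.sum_nonneg fun _ _ => Finset.sum_nonneg fun _ _ => zero_le_one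
  -- `N` counts the index tuples of all orders, and `K * θ` bounds the diagonal cost of one
  -- monomial. Taking `W₀ ≥ N * K` makes the total `N * K * θ` at most `δ` for `θ = δ / W₀`.
  obtain ⟨W₀, hW1, hNKW⟩ : ∃ W₀ : ℝ, 1 ≤ W₀ ∧ N * K ≤ W₀ :=
    ⟨max 1 (N * K), le_max_left _ _, le_max_right _ _⟩
  refine ⟨W₀ ^ (2 * d), one_le_pow₀ hW1, fun c μ δ σ hc hδ hδ1 hA hσ => ?_⟩
  obtain ⟨θ, hθ⟩ : ∃ θ : ℝ, θ = δ / W₀ := ⟨_, rfl⟩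
  have hW0 : 0 < W₀ := by linarith
  have hθ0 : 0 < θ := by rw [hθ]; positivity
  have hθ1 : θ ≤ 1 := hθ ▸ (div_le_one hW0).2 (hδ1.trans hW1)
  obtain ⟨u, hu⟩ : ∃ u : Poly, u = ∑ i, (MvPolynomial.C θ⁻¹ * MvPolynomial.X i) ^ 2 := ⟨_, rfl⟩
  have hus : IsSumSq u := hu ▸ IsSumSq.sum_sq _ _
  have hud : u ^ d = MvPolynomial.C (θ⁻¹ ^ (2 * d)) * normSqPoly n ^ d := by
    rw [hu, normSqPoly, pow_mul, MvPolynomial.C_pow, ← mul_pow, Finset.mul_sum]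
    congr 1
    refine Finset.sum_congr rfl fun i _ => ?_
    rw [mul_pow, MvPolynomial.C_pow]
  have hNK : N * K * θ ≤ δ := by
    calc N * K * θ ≤ W₀ * θ := by gcongr
      _ = δ := by rw [hθ]; field_simp
  have hσθ : N * K * θ * θ⁻¹ ^ (2 * d) ≤ σ := by
    calc N * K * θ * θ⁻¹ ^ (2 * d) ≤ δ * θ⁻¹ ^ (2 * d) := by gcongr
      _ = W₀ ^ (2 * d) / δ ^ (2 * d - 1) := by
        rw [hθ, inv_div, div_pow]
        have : δ ^ (2 * d) = δ ^ (2 * d - 1) * δ := by rw [← pow_succ]; congr 1; omega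
        rw [this]
        field_simp
      _ ≤ σ := by rwa [div_le_iff₀ (by positivity)]
  have hσ0 : 0 ≤ σ := le_trans (by positivity) hσθ
  have hlow : IsSoSMatrix ((Matrix.of fun a b => c 2 ![a, b] + c 2 ![b, a]).map
      (MvPolynomial.C : ℝ → Poly) + Matrix.diagonal fun _ => MvPolynomial.C (μ - δ)) := by
    convert isSoSMatrix_map_C hA using 1
    ext a b : 1
    by_cases h : a = b <;> simp [h]
  have hhigh : IsSoSMatrix (∑ j ∈ (Finset.range (p + 1)), ∑ κ : Fin j → Fin n,
      (if 3 ≤ j then polyHessian (MvPolynomial.monomial (indexExponent κ) (c j κ) : Poly) else 0) +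
      (∑ j ∈ (Finset.range (p + 1)), ∑ κ : Fin j → Fin n,
        Matrix.diagonal fun _ => MvPolynomial.C (K * θ) * (1 + u ^ d))) := by
    rw [← Finset.sum_add_distrib]
    refine IsSoSMatrix.sum fun j hj => ?_
    rw [← Finset.sum_add_distrib]
    refine IsSoSMatrix.sum fun κ _ => ?_
    split_ifs with h
    · have hj' : j ≤ p := Nat.lt_succ_iff.1 (Finset.mem_range.1 hj)
      have := isSoSMatrix_polyHessian_monomial_add (d := d) (α := indexExponent κ)
        (by rwa [degree_indexExponent]) (by rw [degree_indexExponent]; omega)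
        (hc j h hj' κ) hθ0 hθ1
      rwa [← mul_assoc, ← hK, ← hu] at this
    · rw [zero_add]
      exact isSoSMatrix_diagonal fun _ => (MvPolynomial.isSumSq_C (by positivity)).mul
        (IsSumSq.one.add (hus.pow_of_commRing d))
  have hsum : (∑ j ∈ (Finset.range (p + 1)), ∑ κ : Fin j → Fin n,
        Matrix.diagonal fun _ : Fin n => MvPolynomial.C (K * θ) * (1 + u ^ d)) =
      Matrix.diagonal fun _ : Fin n => MvPolynomial.C (N * K * θ) * (1 + u ^ d) := by
    have h1 : (Matrix.diagonal fun _ : Fin n => MvPolynomial.C (N * K * θ) * (1 + u ^ d)) =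
        (MvPolynomial.C N : Poly) •
          Matrix.diagonal fun _ : Fin n => MvPolynomial.C (K * θ) * (1 + u ^ d) := by
      rw [← Matrix.diagonal_smul]
      congr 1
      ext1 i
      rw [Pi.smul_apply, smul_eq_mul, mul_assoc N, MvPolynomial.C_mul, mul_assoc]
    rw [h1, hN, map_sum, Finset.sum_smul]
    refine Finset.sum_congr rfl fun j _ => ?_
    rw [map_sum, Finset.sum_smul]
    simp
  have hT : polyHessian (tensorPolynomial p c) =
      (Matrix.of fun a b => c 2 ![a, b] + c 2 ![b, a]).map (MvPolynomial.C : ℝ → Poly) +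
      ∑ j ∈ (Finset.range (p + 1)), ∑ κ : Fin j → Fin n,
        if 3 ≤ j then polyHessian (MvPolynomial.monomial (indexExponent κ) (c j κ) : Poly)
          else 0 := by
    rw [tensorPolynomial, polyHessian_sum, ← polyHessian_quadratic,
      ← Finset.add_sum_erase _ _ (Finset.mem_range.2 (by omega : 2 < p + 1)),
      ← Finset.add_sum_erase (Finset.range (p + 1)) (fun j => ∑ κ : Fin j → Fin n,
        if 3 ≤ j then polyHessian (MvPolynomial.monomial (indexExponent κ) (c j κ) : Poly)
          else 0) (Finset.mem_range.2 (by omega : 2 < p + 1))]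
    simp only [show ¬ 3 ≤ 2 by norm_num, if_false, Finset.sum_const_zero, zero_add]
    congr 1
    refine Finset.sum_congr rfl fun j hj => ?_
    rw [polyHessian_sum]
    refine Finset.sum_congr rfl fun κ _ => ?_
    split_ifs with h
    · rfl
    · have := Finset.ne_of_mem_erase hj
      exact polyHessian_monomial_of_degree_le_one (by rw [degree_indexExponent]; omega) _
  have hreg := isSoSMatrix_polyHessian_normSqPoly_pow_sub (n := n)
    (τ := σ / (2 * d + 2)) (by positivity) d
  have hrem : IsSoSMatrix (Matrix.diagonal fun _ : Fin n =>
      (MvPolynomial.C (δ - N * K * θ) +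
        MvPolynomial.C (σ - N * K * θ * θ⁻¹ ^ (2 * d)) * normSqPoly n ^ d : Poly)) :=
    isSoSMatrix_diagonal fun _ => (MvPolynomial.isSumSq_C (by linarith)).add
      ((MvPolynomial.isSumSq_C (by linarith)).mul (isSumSq_normSqPoly.pow_of_commRing d))
  rw [hsum] at hhigh
  convert (hlow.add hhigh).add (hreg.add hrem) using 1
  rw [polyHessian_add, polyHessian_add, hT, polyHessian_C_mul _ (normSqPoly n),
    polyHessian_normSqPoly]
  have e1 : (2 * ((d : ℝ) + 1) * (σ / (2 * d + 2))) = σ := by field_simp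
  rw [e1, hud]
  -- Diagonal bookkeeping: `μ` is split into `μ - δ`, the cost of the higher-order terms, and the
  -- remainder in `hrem`; `σ ‖X‖ ^ (2 d)` is subtracted because `hreg` supplies the Hessian of the
  -- regularizer minus that diagonal.
  have e2 : ((MvPolynomial.C (μ / 2) : Poly) • Matrix.diagonal fun _ : Fin n => (2 : Poly)) =
      (Matrix.diagonal fun _ => MvPolynomial.C (μ - δ)) +
      (Matrix.diagonal fun _ : Fin n => MvPolynomial.C (N * K * θ) *
        (1 + MvPolynomial.C (θ⁻¹ ^ (2 * d)) * normSqPoly n ^ d)) -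
      (Matrix.diagonal fun _ : Fin n => MvPolynomial.C σ * normSqPoly n ^ d) +
      (Matrix.diagonal fun _ : Fin n => (MvPolynomial.C (δ - N * K * θ) +
        MvPolynomial.C (σ - N * K * θ * θ⁻¹ ^ (2 * d)) * normSqPoly n ^ d : Poly)) := by
    rw [← Matrix.diagonal_smul, Matrix.diagonal_add, Matrix.diagonal_sub, Matrix.diagonal_add]
    congr 1
    ext1 i
    have h2 : (2 : Poly) = MvPolynomial.C 2 := rfl
    have h3 : (MvPolynomial.C μ : Poly) = MvPolynomial.C (μ / 2) * 2 := by
      rw [h2, ← MvPolynomial.C_mul, div_mul_cancel₀ _ two_ne_zero]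
    simp only [Pi.smul_apply, smul_eq_mul, map_sub, map_mul] at h3 ⊢
    rw [← h3]
    ring
  rw [e2]
  abel

end TaylorPolynomial

/-! ### From the polynomial certificate to the model of `f` -/

section Model

variable {n : ℕ}

local notation "Euc" => EuclideanSpace ℝ (Fin n)

/-- The coefficients of the Taylor polynomial of `f` at `x`. -/
noncomputable def taylorCoeff (f : Euc → ℝ) (x : Euc) (j : ℕ) (κ : Fin j → Fin n) : ℝ :=
  1 / (j.factorial : ℝ) *
    iteratedFDeriv ℝ j f x (fun l => EuclideanSpace.single (κ l) (1 : ℝ))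

theorem ContinuousMultilinearMap.apply_const_eq_sum_single {j : ℕ}
    (T : ContinuousMultilinearMap ℝ (fun _ : Fin j => Euc) ℝ) (m : Fin j → Euc) :
    T m = ∑ κ : Fin j → Fin n,
      (∏ l, m l (κ l)) * T (fun l => EuclideanSpace.single (κ l) (1 : ℝ)) := by
  have h : m = fun l => ∑ i, m l i • EuclideanSpace.single i (1 : ℝ) := by
    ext l i
    simp [Finset.sum_apply, Pi.single_apply]
  conv_lhs => rw [h, ContinuousMultilinearMap.map_sum]
  refine Finset.sum_congr rfl fun κ _ => ?_
  rw [ContinuousMultilinearMap.map_smul_univ, smul_eq_mul]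

theorem abs_taylorCoeff_le (f : Euc → ℝ) (x : Euc) (j : ℕ) (κ : Fin j → Fin n) :
    |taylorCoeff f x j κ| ≤ ‖iteratedFDeriv ℝ j f x‖ := by
  rw [taylorCoeff, abs_mul]
  have h1 : |1 / (j.factorial : ℝ)| ≤ 1 := by
    rw [abs_of_nonneg (by positivity)]
    exact div_le_one_of_le₀ (by exact_mod_cast j.factorial_pos) (by positivity)
  have h2 := (iteratedFDeriv ℝ j f x).le_opNorm
    (fun l => EuclideanSpace.single (κ l) (1 : ℝ))
  simp only [PiLp.norm_single, norm_one, Finset.prod_const_one, mul_one,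
    Real.norm_eq_abs] at h2
  calc _ ≤ 1 * ‖iteratedFDeriv ℝ j f x‖ := by gcongr
    _ = _ := one_mul _

theorem taylorModel_eq_eval (p : ℕ) (f : Euc → ℝ) (x s : Euc) :
    taylorModel p f x s =
      MvPolynomial.eval (fun i => s i) (tensorPolynomial p (taylorCoeff f x)) := by
  rw [taylorModel, tensorPolynomial, map_sum]
  refine Finset.sum_congr rfl fun j _ => ?_
  rw [map_sum, ContinuousMultilinearMap.apply_const_eq_sum_single, Finset.mul_sum]
  refine Finset.sum_congr rfl fun κ _ => ?_
  have h : ∀ t : Finset (Fin j), MvPolynomial.eval (fun i => s i)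
      (MvPolynomial.monomial (∑ l ∈ t, Finsupp.single (κ l) 1) (1 : ℝ)) = ∏ l ∈ t, s (κ l) := by
    intro t
    rw [MvPolynomial.monomial_sum_one, map_prod]
    refine Finset.prod_congr rfl fun l _ => ?_
    simp [MvPolynomial.eval_monomial]
  rw [← mul_one (taylorCoeff f x j κ), ← MvPolynomial.C_mul_monomial, map_mul, indexExponent, h,
    MvPolynomial.eval_C, taylorCoeff]
  ring

theorem hessianMatrix_isSymm {f : Euc → ℝ} (hf : ContDiff ℝ 2 f) (x : Euc) (a b : Fin n) :
    hessianMatrix f x a b = hessianMatrix f x b a := by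
  simp only [hessianMatrix, Matrix.of_apply]
  exact IsSymmSndFDerivAt.iteratedFDeriv_cons
    (hf := hf.contDiffAt.isSymmSndFDerivAt (by simp))

theorem hessianMatrix_isHermitian {f : Euc → ℝ} (hf : ContDiff ℝ 2 f) (x : Euc) :
    (hessianMatrix f x).IsHermitian := by
  ext a b
  simpa using hessianMatrix_isSymm hf x b a

theorem taylorCoeff_two_add {f : Euc → ℝ} (hf : ContDiff ℝ 2 f) (x : Euc) :
    (Matrix.of fun a b => taylorCoeff f x 2 ![a, b] + taylorCoeff f x 2 ![b, a]) =
      hessianMatrix f x := by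
  have h : ∀ a b, taylorCoeff f x 2 ![a, b] = 1 / 2 * hessianMatrix f x a b := by
    intro a b
    have h1 : (fun l => EuclideanSpace.single (![a, b] l) (1 : ℝ)) =
        ![EuclideanSpace.single a (1 : ℝ), EuclideanSpace.single b (1 : ℝ)] := by
      ext l : 1
      fin_cases l <;> rfl
    rw [taylorCoeff, hessianMatrix, Matrix.of_apply, h1, Nat.factorial_two, Nat.cast_ofNat]
  ext a b
  rw [Matrix.of_apply, h, h, hessianMatrix_isSymm hf x b a]
  ring

theorem iteratedFDeriv_two_const_eq (f : Euc → ℝ) (x s : Euc) :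
    iteratedFDeriv ℝ 2 f x (fun _ => s) =
      dotProduct (fun i => s i) ((hessianMatrix f x).mulVec fun i => s i) := by
  rw [ContinuousMultilinearMap.apply_const_eq_sum_single]
  simp only [dotProduct, Matrix.mulVec, Finset.mul_sum]
  rw [← Fintype.sum_prod_type', ← (finTwoArrowEquiv (Fin n)).symm.sum_comp]
  refine Finset.sum_congr rfl fun y _ => ?_
  have h : (fun l => EuclideanSpace.single ((finTwoArrowEquiv (Fin n)).symm y l) (1 : ℝ)) =
      ![EuclideanSpace.single y.1 (1 : ℝ), EuclideanSpace.single y.2 (1 : ℝ)] := by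
    ext l : 1
    fin_cases l <;> rfl
  rw [h, hessianMatrix, Matrix.of_apply, Fin.prod_univ_two]
  simp [finTwoArrowEquiv]
  ring

theorem dotProduct_self_eq_norm_sq (s : Euc) :
    dotProduct (fun i => s i) (fun i => s i) = ‖s‖ ^ 2 := by
  rw [EuclideanSpace.real_norm_sq_eq]
  simp [dotProduct, sq]

theorem posSemidef_hessianMatrix_add_iff {f : Euc → ℝ} (hf : ContDiff ℝ 2 f) (x : Euc) (t : ℝ) :
    (hessianMatrix f x + Matrix.diagonal fun _ => t).PosSemidef ↔
      ∀ s : Euc, 0 ≤ iteratedFDeriv ℝ 2 f x (fun _ => s) + t * ‖s‖ ^ 2 := by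
  have hq : ∀ s : Euc, iteratedFDeriv ℝ 2 f x (fun _ => s) + t * ‖s‖ ^ 2 =
      dotProduct (fun i => s i)
        ((hessianMatrix f x + Matrix.diagonal fun _ => t).mulVec fun i => s i) := by
    intro s
    rw [iteratedFDeriv_two_const_eq, Matrix.add_mulVec, dotProduct_add,
      ← dotProduct_self_eq_norm_sq]
    congr 1
    simp [dotProduct, Matrix.mulVec_diagonal, Finset.mul_sum]
    exact Finset.sum_congr rfl fun i _ => by ring
  rw [Matrix.posSemidef_iff_dotProduct_mulVec]
  constructor
  · rintro ⟨-, h⟩ s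
    rw [hq]
    simpa using h (fun i => s i)
  · intro h
    refine ⟨(hessianMatrix_isHermitian hf x).add (Matrix.isHermitian_diagonal _), fun v => ?_⟩
    have := h (WithLp.toLp 2 v)
    rw [hq] at this
    simpa using this

theorem posSemidef_hessianMatrix_add_iff_spectrum {f : Euc → ℝ} (hf : ContDiff ℝ 2 f) (x : Euc)
    (t : ℝ) : (hessianMatrix f x + Matrix.diagonal fun _ => t).PosSemidef ↔
      ∀ lam ∈ spectrum ℝ (hessianMatrix f x), -t ≤ lam := by
  rw [Matrix.posSemidef_iff_isHermitian_and_spectrum_nonneg]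
  have h1 : (Matrix.diagonal fun _ : Fin n => t) = algebraMap ℝ _ t := by
    rw [Matrix.algebraMap_eq_diagonal]; rfl
  have h2 := (hessianMatrix_isHermitian hf x).add
    (Matrix.isHermitian_diagonal (fun _ : Fin n => t))
  rw [and_iff_right h2, h1, ← spectrum.add_singleton_eq]
  simp only [Set.add_singleton, Set.image_subset_iff]
  refine forall₂_congr fun lam _ => ?_
  simp only [Set.mem_preimage, Set.mem_ofPred_eq]
  constructor <;> intro h <;> linarith

theorem posSemidef_hessianMatrix_add_of_le {f : Euc → ℝ} (hf : ContDiff ℝ 2 f) (x : Euc)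
    {t : ℝ} (ht : -t ≤ lambdaMin f x) :
    (hessianMatrix f x + Matrix.diagonal fun _ => t).PosSemidef := by
  rw [posSemidef_hessianMatrix_add_iff_spectrum hf]
  intro lam hlam
  refine ht.trans (csInf_le ?_ hlam)
  rw [(hessianMatrix_isHermitian hf x).spectrum_real_eq_range_eigenvalues]
  exact (Set.finite_range _).bddBelow

theorem neg_lambdaMin_le {f : Euc → ℝ} (hf : ContDiff ℝ 2 f) (x : Euc) :
    -lambdaMin f x ≤ ‖iteratedFDeriv ℝ 2 f x‖ := by
  -- An empty spectrum arises in dimension `0`; there `lambdaMin` takes the default value `sInf ∅ =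
  -- 0`.
  rcases (spectrum ℝ (hessianMatrix f x)).eq_empty_or_nonempty with h | h
  · simp [lambdaMin, h]
  · rw [neg_le]
    refine le_csInf h ?_
    rw [← posSemidef_hessianMatrix_add_iff_spectrum hf, posSemidef_hessianMatrix_add_iff hf]
    intro s
    have := (iteratedFDeriv ℝ 2 f x).le_opNorm (fun _ => s)
    rw [Real.norm_eq_abs] at this
    simp only [Finset.prod_const, Finset.card_univ, Fintype.card_fin] at this
    linarith [neg_abs_le (iteratedFDeriv ℝ 2 f x fun _ => s)]

namespace ConvexityCase

theorem Applies.shift_nonneg {δ lam : ℝ} {c : ConvexityCase} (hδ : 0 < δ) (h : c.Applies δ lam) :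
    0 ≤ c.shift δ lam := by
  cases c <;> simp only [Applies, shift] at * <;> linarith

theorem Applies.le_add_shift {δ lam : ℝ} {c : ConvexityCase} (h : c.Applies δ lam) :
    δ ≤ lam + c.shift δ lam := by
  cases c <;> simp only [Applies, shift] at * <;> linarith

end ConvexityCase

theorem ConvexityCase.Applies.posSemidef {f : Euc → ℝ} (hf : ContDiff ℝ 2 f) {x : Euc} {δ : ℝ}
    {c : ConvexityCase} (h : c.Applies δ (lambdaMin f x)) :
    (hessianMatrix f x + Matrix.diagonal fun _ =>
      c.shift δ (lambdaMin f x) - δ).PosSemidef :=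
  posSemidef_hessianMatrix_add_of_le hf x (by linarith [h.le_add_shift])

theorem eval_normSqPoly (s : Euc) : MvPolynomial.eval (fun i => s i) (normSqPoly n) = ‖s‖ ^ 2 := by
  rw [EuclideanSpace.real_norm_sq_eq]
  simp [normSqPoly]

variable (n) in
/-- The model is SoS-convex for regularization parameters of order `δ ^ (1 - 2 d)`. -/
theorem exists_forall_isSoSConvex {d p : ℕ} (hd : 1 ≤ d) (hp2 : 2 ≤ p) (hp : p ≤ 2 * d + 2)
    (hreg : regPower p = 2 * d + 2) {B : ℝ} (hB : 0 ≤ B) :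
    ∃ W : ℝ, 1 ≤ W ∧ ∀ (f : Euc → ℝ) (x : Euc) (c : ConvexityCase) (δ σ : ℝ),
      ContDiff ℝ 2 f → (∀ j, 1 ≤ j → j ≤ p → ‖iteratedFDeriv ℝ j f x‖ ≤ B) → 0 < δ → δ ≤ 1 →
      c.Applies δ (lambdaMin f x) → W ≤ σ * δ ^ (2 * d - 1) →
      IsSoSConvex (sosTaylorModel p f δ c σ x) := by
  obtain ⟨W, hW, h⟩ := exists_forall_isSoSMatrix n hd hp2 hp hB
  refine ⟨W, hW, fun f x c δ σ hf hb hδ hδ1 hc hσ => ⟨_, fun s => ?_,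
    h (taylorCoeff f x) (c.shift δ (lambdaMin f x)) δ σ
      (fun j h3 hj κ => (abs_taylorCoeff_le f x j κ).trans (hb j (by omega) hj)) hδ hδ1 ?_ hσ⟩⟩
  · rw [sosTaylorModel, taylorModel_eq_eval, hreg]
    simp only [map_add, map_mul, map_pow, MvPolynomial.eval_C, eval_normSqPoly]
    push_cast
    ring
  · rw [taylorCoeff_two_add hf]
    exact hc.posSemidef hf

end Model

/-! ### Stationarity, gradient bounds and decrease for a global minimizer of the model -/

section Step

variable {n : ℕ}

local notation "Euc" => EuclideanSpace ℝ (Fin n)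

theorem taylorModel_eq_vectorTaylor (p : ℕ) (f : Euc → ℝ) (x : Euc) :
    taylorModel p f x = vectorTaylor p f x := rfl

theorem norm_gradient_eq (f : Euc → ℝ) (x : Euc) : ‖gradient f x‖ = ‖fderiv ℝ f x‖ := by
  rw [gradient, LinearIsometryEquiv.norm_map]

theorem stationary_of_forall_sosTaylorModel_le {d q : ℕ} {f : Euc → ℝ}
    (hf : ContDiff ℝ (q + 1 : ℕ) f) (hreg : regPower (q + 1) = 2 * d + 2) {δ σ : ℝ}
    {c : ConvexityCase} {x s : Euc} (hs : ∀ s', sosTaylorModel (q + 1) f δ c σ x s ≤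
      sosTaylorModel (q + 1) f δ c σ x s') :
    vectorTaylor q (fderiv ℝ f) x s +
      (c.shift δ (lambdaMin f x) + σ * ‖s‖ ^ (2 * d)) • innerSL ℝ s = 0 := by
  have h0 := (hasStrictFDerivAt_norm_sq s).hasFDerivAt
  have h1 := hasFDerivAt_vectorTaylor hf x s
  have h2 := h0.const_mul (c.shift δ (lambdaMin f x) / 2)
  have h3 := (h0.pow (d + 1)).const_mul (σ / ((2 * d + 2 : ℕ) : ℝ))
  have h6 : sosTaylorModel (q + 1) f δ c σ x = (vectorTaylor (q + 1) f x +
      (fun s => c.shift δ (lambdaMin f x) / 2 * ‖s‖ ^ 2)) +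
      fun s => σ / ((2 * d + 2 : ℕ) : ℝ) * (‖s‖ ^ 2) ^ (d + 1) := by
    ext s
    simp only [sosTaylorModel, Pi.add_apply, hreg, taylorModel_eq_vectorTaylor, ← pow_mul]
    rfl
  have h4 := ((h1.add h2).add h3).congr_of_eventuallyEq (.of_eq h6)
  have h7 := IsLocalMin.hasFDerivAt_eq_zero (Filter.Eventually.of_forall hs) h4
  rw [← h7]
  ext v
  have : (2 * (d : ℝ) + 2) ≠ 0 := by positivity
  simp [pow_mul]
  field_simp
  ring

theorem norm_fderiv_add_sub_vectorTaylor_le {q : ℕ} {L : ℝ} {f : Euc → ℝ}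
    (hf : IsLipschitzSmooth (q + 1) L f) (hL : 0 ≤ L) (x s : Euc) :
    ‖fderiv ℝ f (x + s) - vectorTaylor q (fderiv ℝ f) x s‖ ≤ L * ‖s‖ ^ (q + 1) := by
  have h := norm_sub_vectorTaylor_le (k := q) (g := fderiv ℝ f)
    (hf.contDiff.fderiv_right (by norm_cast)) (M := (q.factorial : ℝ) * L) (x := x)
    (fun y => by rw [norm_iteratedFDeriv_fderiv_sub]; exact hf.lipschitz y x) s
  refine h.trans ?_
  rw [div_le_iff₀ (by positivity)]
  have h1 : (q.factorial : ℝ) ≤ (q + 1).factorial := by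
    exact_mod_cast Nat.factorial_le (Nat.le_succ q)
  have h2 : 0 ≤ L * ‖s‖ ^ (q + 1) := by positivity
  nlinarith

theorem abs_sub_taylorModel_le {q : ℕ} {L : ℝ} {f : Euc → ℝ}
    (hf : IsLipschitzSmooth (q + 1) L f) (hL : 0 ≤ L) (x s : Euc) :
    |f (x + s) - taylorModel (q + 1) f x s| ≤ L * ‖s‖ ^ (q + 2) := by
  have h := norm_sub_vectorTaylor_le (k := q + 1) (g := f) hf.contDiff
    (M := (q.factorial : ℝ) * L) (x := x) (fun y => hf.lipschitz y x) s
  refine h.trans ?_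
  rw [div_le_iff₀ (by positivity)]
  have h1 : (q.factorial : ℝ) ≤ (q + 1 + 1).factorial := by
    exact_mod_cast Nat.factorial_le (by omega)
  have h2 : 0 ≤ L * ‖s‖ ^ (q + 2) := by positivity
  nlinarith

theorem norm_gradient_add_le {d q : ℕ} {L : ℝ} {f : Euc → ℝ}
    (hf : IsLipschitzSmooth (q + 1) L f) (hL : 0 ≤ L)
    (hreg : regPower (q + 1) = 2 * d + 2) {δ σ : ℝ} (hσ : 0 ≤ σ)
    {c : ConvexityCase} {x s : Euc} (hμ : 0 ≤ c.shift δ (lambdaMin f x))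
    (hs : ∀ s', sosTaylorModel (q + 1) f δ c σ x s ≤ sosTaylorModel (q + 1) f δ c σ x s') :
    ‖gradient f (x + s)‖ ≤ L * ‖s‖ ^ (q + 1) + c.shift δ (lambdaMin f x) * ‖s‖ +
      σ * ‖s‖ ^ (2 * d + 1) := by
  have h1 := stationary_of_forall_sosTaylorModel_le hf.contDiff hreg hs
  have h2 := norm_fderiv_add_sub_vectorTaylor_le hf hL x s
  rw [norm_gradient_eq]
  have h3 : fderiv ℝ f (x + s) = (fderiv ℝ f (x + s) - vectorTaylor q (fderiv ℝ f) x s) -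
      (c.shift δ (lambdaMin f x) + σ * ‖s‖ ^ (2 * d)) • innerSL ℝ s := by
    rw [eq_neg_of_add_eq_zero_left h1]; abel
  rw [h3]
  refine (norm_sub_le _ _).trans ?_
  rw [norm_smul, innerSL_apply_norm, Real.norm_of_nonneg (by positivity)]
  have h4 : σ * ‖s‖ ^ (2 * d + 1) = σ * ‖s‖ ^ (2 * d) * ‖s‖ := by ring
  rw [h4]
  linarith

/-- Solve the stationarity equation for the constant term `∇f(x)`; for `‖s‖ ≤ 1` each of the other
`q` Taylor terms is at most `B * ‖s‖`. -/
theorem norm_gradient_le {d q : ℕ} {B : ℝ} {f : Euc → ℝ} (hf : ContDiff ℝ (q + 1 : ℕ) f)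
    (hreg : regPower (q + 1) = 2 * d + 2) {δ σ : ℝ} (hσ : 0 ≤ σ)
    {c : ConvexityCase} {x s : Euc} (hμ : 0 ≤ c.shift δ (lambdaMin f x))
    (hB : ∀ j, 1 ≤ j → j ≤ q + 1 → ‖iteratedFDeriv ℝ j f x‖ ≤ B)
    (hs : ∀ s', sosTaylorModel (q + 1) f δ c σ x s ≤ sosTaylorModel (q + 1) f δ c σ x s')
    (hs1 : ‖s‖ ≤ 1) :
    ‖gradient f x‖ ≤ (q * B + c.shift δ (lambdaMin f x)) * ‖s‖ + σ * ‖s‖ ^ (2 * d + 1) := by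
  have h1 := stationary_of_forall_sosTaylorModel_le hf hreg hs
  rw [norm_gradient_eq]
  rw [vectorTaylor, Finset.sum_range_succ'] at h1
  set S := ∑ j ∈ Finset.range q, (1 / ((j + 1).factorial : ℝ)) •
    iteratedFDeriv ℝ (j + 1) (fderiv ℝ f) x (fun _ => s) with hS
  have h2 : fderiv ℝ f x = -S -
      (c.shift δ (lambdaMin f x) + σ * ‖s‖ ^ (2 * d)) • innerSL ℝ s := by
    simp only [Nat.factorial_zero, Nat.cast_one, div_one, one_smul,
      iteratedFDeriv_zero_apply] at h1
    rw [← sub_eq_zero, ← h1]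
    abel
  have h3 : ‖S‖ ≤ q * B * ‖s‖ := by
    have h4 : ∀ j ∈ Finset.range q, ‖(1 / ((j + 1).factorial : ℝ)) •
        iteratedFDeriv ℝ (j + 1) (fderiv ℝ f) x (fun _ => s)‖ ≤ B * ‖s‖ := by
      intro j hj
      have hj' := Finset.mem_range.1 hj
      have h5 : ‖iteratedFDeriv ℝ (j + 1) (fderiv ℝ f) x‖ ≤ B := by
        rw [norm_iteratedFDeriv_fderiv]
        exact hB _ (by omega) (by omega)
      have hB0 : 0 ≤ B := (norm_nonneg _).trans h5
      rw [norm_smul, Real.norm_of_nonneg (by positivity)]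
      have h6 : 1 / ((j + 1).factorial : ℝ) ≤ 1 :=
        div_le_one_of_le₀ (by exact_mod_cast (j + 1).factorial_pos) (by positivity)
      have h7 := (iteratedFDeriv ℝ (j + 1) (fderiv ℝ f) x).le_opNorm (fun _ => s)
      simp only [Finset.prod_const, Finset.card_univ, Fintype.card_fin] at h7
      calc _ ≤ 1 * (B * ‖s‖) := by
            gcongr
            refine h7.trans ?_
            gcongr
            exact pow_le_of_le_one (norm_nonneg _) hs1 (by omega)
        _ = _ := one_mul _
    refine (norm_sum_le_of_le _ h4).trans ?_
    simp [mul_assoc]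
  rw [h2]
  refine (norm_sub_le _ _).trans ?_
  rw [norm_neg, norm_smul, innerSL_apply_norm, Real.norm_of_nonneg (by positivity)]
  have h4 : σ * ‖s‖ ^ (2 * d + 1) = σ * ‖s‖ ^ (2 * d) * ‖s‖ := by ring
  rw [h4]
  linarith

/-- Compare with the zero step, where the model equals `f x`, and drop the nonnegative shift term.
-/
theorem le_sub_taylorModel {d p : ℕ} {f : Euc → ℝ} (hreg : regPower p = 2 * d + 2) {δ σ : ℝ}
    {c : ConvexityCase} {x s : Euc} (hμ : 0 ≤ c.shift δ (lambdaMin f x))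
    (hs : ∀ s', sosTaylorModel p f δ c σ x s ≤ sosTaylorModel p f δ c σ x s') :
    σ / (2 * d + 2) * ‖s‖ ^ (2 * d + 2) ≤ f x - taylorModel p f x s := by
  have h := hs 0
  have h0 : taylorModel p f x 0 = f x := by
    rw [taylorModel, Finset.sum_range_succ', Finset.sum_eq_zero]
    · simp
    · intro j _
      rw [iteratedFDeriv_const_apply_succ]
      simp
  simp only [sosTaylorModel, h0, hreg, norm_zero] at h
  push_cast at h
  have h1 : 0 ≤ c.shift δ (lambdaMin f x) / 2 * ‖s‖ ^ 2 := by positivity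
  simp at h
  linarith

/-- Pairing stationarity with `s` expresses the decrease as half the shifted quadratic form, plus
nonnegative terms, plus a cubic error. The form is at least `δ * ‖s‖ ^ 2`, and for short steps the
error costs at most half of the resulting `δ / 2`. -/
theorem quarter_mul_le_sub_taylorModel {d q : ℕ} (hq : 1 ≤ q) {B : ℝ} {f : Euc → ℝ}
    (hf : ContDiff ℝ (q + 1 : ℕ) f) (hreg : regPower (q + 1) = 2 * d + 2) {δ σ : ℝ} (hδ : 0 < δ)
    (hσ : 0 ≤ σ) {c : ConvexityCase} {x s : Euc} (hc : c.Applies δ (lambdaMin f x))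
    (hB : ∀ j, 1 ≤ j → j ≤ q + 1 → ‖iteratedFDeriv ℝ j f x‖ ≤ B)
    (hs : ∀ s', sosTaylorModel (q + 1) f δ c σ x s ≤ sosTaylorModel (q + 1) f δ c σ x s')
    (hs1 : ‖s‖ ≤ 1) (hsδ : (q + 1) * B * ‖s‖ ≤ δ / 4) :
    δ / 4 * ‖s‖ ^ 2 ≤ f x - taylorModel (q + 1) f x s := by
  have h1 := DFunLike.congr_fun (stationary_of_forall_sosTaylorModel_le hf hreg hs) s
  have hμ := hc.shift_nonneg hδ
  have hf2 : ContDiff ℝ 2 f := hf.of_le (by exact_mod_cast (by omega : 2 ≤ q + 1))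
  have h2 := (posSemidef_hessianMatrix_add_iff hf2 x _).1 (hc.posSemidef hf2) s
  set μ := c.shift δ (lambdaMin f x)
  have hB0 : 0 ≤ B := (norm_nonneg _).trans (hB 1 le_rfl (by omega))
  have h3 : vectorTaylor q (fderiv ℝ f) x s s = ∑ j ∈ Finset.range (q + 1),
      (1 / (j.factorial : ℝ)) * iteratedFDeriv ℝ (j + 1) f x (fun _ => s) := by
    simp [vectorTaylor, iteratedFDeriv_const_apply_succ]
  have h4 : taylorModel (q + 1) f x s = (∑ j ∈ Finset.range (q + 1),
      (1 / ((j + 1).factorial : ℝ)) * iteratedFDeriv ℝ (j + 1) f x (fun _ => s)) + f x := by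
    rw [taylorModel, Finset.sum_range_succ']
    simp
  -- The weights `1 / j! - 1 / (j + 1)!` come from subtracting the Taylor sum from its radial
  -- derivative: `0` for the gradient term, `1 / 2` for the Hessian term, and in `[0, 1]` beyond.
  have h5 : -(q * (B * ‖s‖ ^ 3)) + 1 / 2 * iteratedFDeriv ℝ 2 f x (fun _ => s) ≤
      ∑ j ∈ Finset.range (q + 1), (1 / (j.factorial : ℝ) - 1 / ((j + 1).factorial : ℝ)) *
        iteratedFDeriv ℝ (j + 1) f x (fun _ => s) := by
    rw [← Finset.sum_erase_add _ _ (Finset.mem_range.2 (by omega : 1 < q + 1))]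
    refine add_le_add ?_ ?_
    · have hcard : ((Finset.range (q + 1)).erase 1).card = q := by
        rw [Finset.card_erase_of_mem (Finset.mem_range.2 (by omega)), Finset.card_range]; rfl
      have := Finset.card_nsmul_le_sum ((Finset.range (q + 1)).erase 1)
        (fun j => (1 / (j.factorial : ℝ) - 1 / ((j + 1).factorial : ℝ)) *
          iteratedFDeriv ℝ (j + 1) f x (fun _ => s)) (-(B * ‖s‖ ^ 3)) ?_
      · rw [hcard, nsmul_eq_mul] at this
        linarith
      · intro j hj
        obtain ⟨hj1, hj2⟩ := Finset.mem_erase.1 hj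
        have hjq := Finset.mem_range.1 hj2
        rcases Nat.eq_zero_or_pos j with rfl | hj0
        · simp; positivity
        · have h6 : 1 / ((j + 1).factorial : ℝ) ≤ 1 / (j.factorial : ℝ) :=
            one_div_le_one_div_of_le (by positivity)
              (by exact_mod_cast Nat.factorial_le (Nat.le_succ j))
          have h7 : 1 / (j.factorial : ℝ) ≤ 1 :=
            div_le_one_of_le₀ (by exact_mod_cast j.factorial_pos) (by positivity)
          have h8 : 0 ≤ 1 / ((j + 1).factorial : ℝ) := by positivity
          have h9 := (iteratedFDeriv ℝ (j + 1) f x).le_opNorm (fun _ => s)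
          simp only [Finset.prod_const, Finset.card_univ, Fintype.card_fin,
            Real.norm_eq_abs] at h9
          have h10 : ‖iteratedFDeriv ℝ (j + 1) f x‖ * ‖s‖ ^ (j + 1) ≤ B * ‖s‖ ^ 3 := by
            gcongr ?_ * ?_
            · exact hB _ (by omega) (by omega)
            · exact pow_le_pow_of_le_one (norm_nonneg _) hs1 (by omega)
          have h11 := neg_abs_le (iteratedFDeriv ℝ (j + 1) f x fun _ => s)
          have h12 : 0 ≤ B * ‖s‖ ^ 3 := by positivity
          nlinarith
    · norm_num [Nat.factorial]
  have h6 : ∑ j ∈ Finset.range (q + 1), (1 / (j.factorial : ℝ) - 1 / ((j + 1).factorial : ℝ)) *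
        iteratedFDeriv ℝ (j + 1) f x (fun _ => s) =
      vectorTaylor q (fderiv ℝ f) x s s - (taylorModel (q + 1) f x s - f x) := by
    rw [h3, h4, add_sub_cancel_right, ← Finset.sum_sub_distrib]
    exact Finset.sum_congr rfl fun j _ => by ring
  simp only [add_apply, smul_apply, innerSL_apply_apply, real_inner_self_eq_norm_sq, smul_eq_mul,
    zero_apply] at h1
  have h7 : 0 ≤ σ * ‖s‖ ^ (2 * d) * ‖s‖ ^ 2 := by positivity
  have h8 : (q + 1) * B * ‖s‖ * ‖s‖ ^ 2 ≤ δ / 4 * ‖s‖ ^ 2 := by gcongr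
  have h9 : 0 ≤ B * ‖s‖ ^ 3 := by positivity
  have h10 : 0 ≤ μ * ‖s‖ ^ 2 := by positivity
  nlinarith

end Step

/-! ### Bounds on the regularization parameter along a run -/

section Run

variable {n : ℕ}

local notation "Euc" => EuclideanSpace ℝ (Fin n)

theorem exists_regPower_eq {p : ℕ} (hp : 3 ≤ p) :
    ∃ d, 1 ≤ d ∧ regPower p = 2 * d + 2 ∧ p ≤ 2 * d + 1 ∧ 2 * d ≤ p := by
  rcases Nat.even_or_odd p with h | h
  · refine ⟨p / 2, by omega, ?_, ?_, ?_⟩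
    · rw [regPower, if_neg (Nat.not_odd_iff_even.2 h)]
      obtain ⟨m, rfl⟩ := h
      omega
    all_goals omega
  · refine ⟨(p - 1) / 2, by omega, ?_, ?_, ?_⟩
    · rw [regPower, if_pos h]
      obtain ⟨m, rfl⟩ := h
      omega
    all_goals obtain ⟨m, rfl⟩ := h; omega

/-- Iterations with a sufficiently large regularization parameter are successful. -/
theorem exists_forall_lt_ratio {d q : ℕ} (hq : 2 ≤ q) (hreg : regPower (q + 1) = 2 * d + 2)
    (hd1 : q + 1 ≤ 2 * d + 1) (hd2 : 2 * d ≤ q + 1) {L B η : ℝ} (hL : 0 < L) (hB : 0 < B)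
    (hη : η < 1) :
    ∃ S : ℝ, ∀ (f : Euc → ℝ) (x s : Euc) (c : ConvexityCase) (δ σ : ℝ),
      IsLipschitzSmooth (q + 1) L f →
      (∀ j, 1 ≤ j → j ≤ q + 1 → ‖iteratedFDeriv ℝ j f x‖ ≤ B) → 0 < δ → δ ≤ 1 → 0 ≤ σ →
      c.Applies δ (lambdaMin f x) →
      (∀ s', sosTaylorModel (q + 1) f δ c σ x s ≤ sosTaylorModel (q + 1) f δ c σ x s') →
      s ≠ 0 → S < σ * δ →
      η < (f x - f (x + s)) / (f x - taylorModel (q + 1) f x s) := by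
  have hη' : 0 < 1 - η := by linarith
  -- `c₀ * δ` separates short from long steps: below it the quadratic decrease beats the Taylor
  -- remainder, above it the regularization term does.
  obtain ⟨c₀, hc0, hc1, hcB, hcL⟩ : ∃ c₀ : ℝ, 0 < c₀ ∧ c₀ ≤ 1 ∧ (q + 1) * B * c₀ ≤ 1 / 4 ∧
      L * c₀ ≤ (1 - η) / 4 := by
    refine ⟨min 1 (min (1 / (4 * ((q + 1) * B))) ((1 - η) / (4 * L))), by positivity,
      min_le_left _ _, ?_, ?_⟩
    · calc (q + 1) * B * _ ≤ (q + 1) * B * (1 / (4 * ((q + 1) * B))) := by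
            gcongr; exact (min_le_right _ _).trans (min_le_left _ _)
        _ = 1 / 4 := by field_simp
    · calc L * _ ≤ L * ((1 - η) / (4 * L)) := by
            gcongr; exact (min_le_right _ _).trans (min_le_right _ _)
        _ = (1 - η) / 4 := by field_simp
  refine ⟨(2 * d + 2) * L / ((1 - η) * c₀), fun f x s c δ σ hf hb hδ hδ1 hσ hc hs hs0 hS => ?_⟩
  have hr : 0 < ‖s‖ := norm_pos_iff.2 hs0
  have hrem := abs_le.1 (abs_sub_taylorModel_le hf hL.le x s)
  have hD1 := le_sub_taylorModel hreg (hc.shift_nonneg hδ) hs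
  suffices h : L * ‖s‖ ^ (q + 2) < (1 - η) * (f x - taylorModel (q + 1) f x s) by
    have hpos : 0 < f x - taylorModel (q + 1) f x s := by
      have : 0 < (1 - η) * (f x - taylorModel (q + 1) f x s) := lt_of_le_of_lt (by positivity) h
      exact pos_of_mul_pos_right this hη'.le
    rw [lt_div_iff₀ hpos]
    linarith [hrem.2]
  rcases lt_or_ge ‖s‖ (c₀ * δ) with h | h
  · have hcδ : c₀ * δ ≤ 1 := mul_le_one₀ hc1 hδ.le hδ1
    have hs1 : ‖s‖ ≤ 1 := h.le.trans hcδ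
    have hsδ : (q + 1) * B * ‖s‖ ≤ δ / 4 := by
      calc (q + 1) * B * ‖s‖ ≤ (q + 1) * B * (c₀ * δ) := by gcongr
        _ = ((q + 1) * B * c₀) * δ := by ring
        _ ≤ 1 / 4 * δ := by gcongr
        _ = δ / 4 := by ring
    have hD2 := quarter_mul_le_sub_taylorModel (by omega) hf.contDiff hreg hδ hσ hc hb hs hs1 hsδ
    calc L * ‖s‖ ^ (q + 2) ≤ L * ‖s‖ ^ 3 := by
          gcongr L * ?_
          exact pow_le_pow_of_le_one hr.le hs1 (by omega)
      _ = L * ‖s‖ * ‖s‖ ^ 2 := by ring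
      _ < L * (c₀ * δ) * ‖s‖ ^ 2 := by gcongr
      _ = (L * c₀) * (δ * ‖s‖ ^ 2) := by ring
      _ ≤ (1 - η) / 4 * (δ * ‖s‖ ^ 2) := by gcongr
      _ = (1 - η) * (δ / 4 * ‖s‖ ^ 2) := by ring
      _ ≤ _ := by gcongr
  · have h1 : (2 * d + 2) * L < (1 - η) * (σ * (c₀ * δ)) := by
      rw [div_lt_iff₀ (by positivity)] at hS
      linarith
    have h2 : c₀ * δ * ‖s‖ ^ (q + 2) ≤ ‖s‖ ^ (2 * d + 2) := by
      -- For odd `p` the regularizer has the order of the remainder; for even `p` it has one power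
      -- more, which is paid for with `‖s‖ ≥ c₀ * δ`.
      obtain h3 | h3 : 2 * d + 2 = q + 2 ∨ 2 * d + 2 = q + 3 := by omega
      · rw [h3]
        exact mul_le_of_le_one_left (by positivity) (mul_le_one₀ hc1 hδ.le hδ1)
      · rw [h3, pow_succ' _ (q + 2)]
        gcongr
    have h4 : 0 < ‖s‖ ^ (q + 2) := by positivity
    calc L * ‖s‖ ^ (q + 2) = (2 * d + 2) * L * ‖s‖ ^ (q + 2) / (2 * d + 2) := by field_simp
      _ < (1 - η) * (σ * (c₀ * δ)) * ‖s‖ ^ (q + 2) / (2 * d + 2) := by gcongr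
      _ = (1 - η) * (σ / (2 * d + 2) * (c₀ * δ * ‖s‖ ^ (q + 2))) := by ring
      _ ≤ (1 - η) * (σ / (2 * d + 2) * ‖s‖ ^ (2 * d + 2)) := by gcongr
      _ ≤ _ := by gcongr

theorem IsActive.mono {f : Euc → ℝ} {ε : ℝ} {x : ℕ → Euc} {j k : ℕ} (h : IsActive f ε x k)
    (hjk : j ≤ k) : IsActive f ε x j := fun i hi => h i (hi.trans hjk)

theorem ARpSoSRun.σreg_pos {p : ℕ} {f : Euc → ℝ} {ε δ η γ₁ γ₂ σmin : ℝ}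
    (r : ARpSoSRun p f ε δ η γ₁ γ₂ σmin) (hγ₁ : 0 < γ₁) (hσmin : 0 < σmin) {k : ℕ}
    (hk : IsActive f ε r.x k) : 0 < r.σreg k := by
  induction k with
  | zero => rw [r.σreg_zero]; exact hσmin
  | succ k ih =>
    have hk' := hk.mono (Nat.le_succ k)
    by_cases h : η < r.ρ k
    · rw [(r.successful k hk' h).2]
      exact lt_max_of_lt_right hσmin
    · rw [(r.unsuccessful k hk' h).2, r.σ_spec k hk']
      exact mul_pos hγ₁ (lt_max_of_lt_right (ih hk'))

theorem ARpSoSRun.σ_pos {p : ℕ} {f : Euc → ℝ} {ε δ η γ₁ γ₂ σmin : ℝ}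
    (r : ARpSoSRun p f ε δ η γ₁ γ₂ σmin) (hγ₁ : 0 < γ₁) (hσmin : 0 < σmin) {k : ℕ}
    (hk : IsActive f ε r.x k) : 0 < r.σ k := by
  rw [r.σ_spec k hk]
  exact lt_max_of_lt_right (r.σreg_pos hγ₁ hσmin hk)

/-- A zero step would make `x_k` a stationary point of `f`, so the method would have stopped. This
keeps `0 / 0` out of the ratio test. -/
theorem ARpSoSRun.step_ne_zero {p : ℕ} {f : Euc → ℝ} {ε δ η γ₁ γ₂ σmin L : ℝ}
    (r : ARpSoSRun p f ε δ η γ₁ γ₂ σmin) (hp : 3 ≤ p) (hL : 0 ≤ L) (hf : IsLipschitzSmooth p L f)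
    (hε : 0 < ε) (hδ : 0 < δ) (hγ₁ : 0 < γ₁) (hσmin : 0 < σmin) {k : ℕ}
    (hk : IsActive f ε r.x k) : r.s k ≠ 0 := by
  intro h
  obtain ⟨d, -, hreg, -, -⟩ := exists_regPower_eq hp
  obtain ⟨q, rfl⟩ : ∃ q, p = q + 1 := ⟨p - 1, by omega⟩
  have h1 := norm_gradient_add_le hf hL hreg (r.σ_pos hγ₁ hσmin hk).le
    ((r.cvx_spec k hk).shift_nonneg hδ) (r.s_spec k hk)
  rw [h] at h1
  simp at h1
  have h2 := hk k le_rfl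
  rw [h1, norm_zero] at h2
  exact absurd h2 (not_lt.2 hε.le)

variable (n) in
/-- The regularization parameters are at most of order `δ ^ (1 - 2 d)`. -/
theorem exists_forall_σ_mul_le {d p : ℕ} (hp : 3 ≤ p) (hd : 1 ≤ d) (hreg : regPower p = 2 * d + 2)
    (hd1 : p ≤ 2 * d + 1) (hd2 : 2 * d ≤ p) {L η γ₁ γ₂ σmin B : ℝ} (hL : 0 < L) (hB : 0 < B)
    (hη : η < 1) (hγ₁ : 1 < γ₁) (hγ₂ : 0 < γ₂) (hγ₂' : γ₂ < 1) (hσmin : 0 < σmin) :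
    ∃ M : ℝ, 0 < M ∧ ∀ (f : Euc → ℝ) (ε δ : ℝ) (r : ARpSoSRun p f ε δ η γ₁ γ₂ σmin),
      IsLipschitzSmooth p L f → 0 < ε → 0 < δ → δ ≤ 1 →
      ∀ k, IsActive f ε r.x k →
      (∀ i ≤ k, ∀ j, 1 ≤ j → j ≤ p → ‖iteratedFDeriv ℝ j f (r.x i)‖ ≤ B) →
      r.σ k * δ ^ (2 * d - 1) ≤ M := by
  obtain ⟨q, rfl⟩ : ∃ q, p = q + 1 := ⟨p - 1, by omega⟩
  obtain ⟨W, hW1, hW⟩ := exists_forall_isSoSConvex n hd (by omega : 2 ≤ q + 1) (by omega) hreg hB.le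
  obtain ⟨S, hS⟩ := exists_forall_lt_ratio (n := n) (by omega : 2 ≤ q) hreg hd1 hd2 hL hB hη
  obtain ⟨M₀, hM1, hM2, hM3⟩ : ∃ M₀ : ℝ, W ≤ M₀ ∧ S ≤ M₀ ∧ σmin ≤ M₀ :=
    ⟨max W (max S σmin), le_max_left _ _, (le_max_left _ _).trans (le_max_right _ _),
      (le_max_right _ _).trans (le_max_right _ _)⟩
  have hM0 : 0 < M₀ := hσmin.trans_le hM3
  have hγM : M₀ ≤ γ₁ * M₀ := le_mul_of_one_le_left hM0.le hγ₁.le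
  refine ⟨γ₁ * M₀, by positivity, fun f ε δ r hf hε hδ hδ1 => ?_⟩
  have hδd : 0 < δ ^ (2 * d - 1) := by positivity
  have hδd1 : δ ^ (2 * d - 1) ≤ 1 := pow_le_one₀ hδ.le hδ1
  have hf2 : ContDiff ℝ 2 f := hf.contDiff.of_le (by exact_mod_cast (by omega : 2 ≤ q + 1))
  have hmin : σmin * δ ^ (2 * d - 1) ≤ γ₁ * M₀ :=
    (mul_le_of_le_one_right hσmin.le hδd1).trans (hM3.trans hγM)
  have hstep : ∀ k, IsActive f ε r.x k →
      (∀ i ≤ k, ∀ j, 1 ≤ j → j ≤ q + 1 → ‖iteratedFDeriv ℝ j f (r.x i)‖ ≤ B) →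
      r.σreg k * δ ^ (2 * d - 1) ≤ γ₁ * M₀ → r.σ k * δ ^ (2 * d - 1) ≤ γ₁ * M₀ := by
    intro k hk hb hσ
    -- Minimality of `σ̄_k` turns one certified feasible value into an upper bound.
    have h1 : r.σbar k ≤ W / δ ^ (2 * d - 1) := by
      refine (r.σbar_spec k hk).2 ⟨by positivity, ?_⟩
      exact hW f (r.x k) (r.cvx k) δ _ hf2 (hb k le_rfl) hδ hδ1 (r.cvx_spec k hk)
        (div_mul_cancel₀ _ hδd.ne').ge
    rw [le_div_iff₀ hδd] at h1
    rw [r.σ_spec k hk, max_mul_of_nonneg _ _ hδd.le]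
    exact max_le (h1.trans (hM1.trans hγM)) hσ
  intro k hk hb
  refine hstep k hk hb ?_
  induction k with
  | zero => rwa [r.σreg_zero]
  | succ k ih =>
    have hk' := hk.mono (Nat.le_succ k)
    have hb' : ∀ i ≤ k, ∀ j, 1 ≤ j → j ≤ q + 1 → ‖iteratedFDeriv ℝ j f (r.x i)‖ ≤ B :=
      fun i hi => hb i (hi.trans (Nat.le_succ k))
    have hσ := hstep k hk' hb' (ih hk' hb')
    have hσ0 := r.σ_pos (by linarith) hσmin hk'
    by_cases h : η < r.ρ k
    · rw [(r.successful k hk' h).2, max_mul_of_nonneg _ _ hδd.le]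
      refine max_le (le_trans ?_ hσ) hmin
      gcongr
      exact mul_le_of_le_one_left hσ0.le hγ₂'.le
    · rw [(r.unsuccessful k hk' h).2, mul_assoc]
      gcongr
      refine le_trans ?_ hM2
      -- Failure of the ratio test forces `σ_k * δ ≤ S`; since `2 d - 1 ≥ 1` and `δ ≤ 1`, the same
      -- bound holds with `δ ^ (2 d - 1)`.
      rw [r.ρ_spec k hk'] at h
      have h1 := mt (hS f (r.x k) (r.s k) (r.cvx k) δ (r.σ k) hf (hb' k le_rfl) hδ hδ1 hσ0.le
        (r.cvx_spec k hk') (r.s_spec k hk')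
        (r.step_ne_zero hp hL.le hf hε hδ (by linarith) hσmin hk')) h
      refine le_trans ?_ (not_lt.1 h1)
      gcongr
      exact pow_le_of_le_one hδ.le hδ1 (by omega)

/-- Otherwise the factor `1 / 2`, raised to a power of at least 2, makes each summand at most `ε /
4`. -/
theorem half_min_rpow_lt {p P : ℕ} (hp : 2 ≤ p) (hP : 2 ≤ P) {L σ ε r : ℝ} (hL : 0 < L)
    (hσ : 0 < σ) (hε : 0 < ε) (hr : 0 ≤ r) (h : ε < L * r ^ p + σ * r ^ P) :
    1 / 2 * min ((ε / L) ^ (1 / (p : ℝ))) ((ε / σ) ^ (1 / (P : ℝ))) < r := by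
  by_contra! hle
  have aux : ∀ (m : ℕ) (b : ℝ), 2 ≤ m → 0 < b → r ≤ 1 / 2 * (ε / b) ^ (1 / (m : ℝ)) →
      b * r ^ m ≤ ε / 4 := by
    intro m b hm hb hrb
    have h1 : r ^ m ≤ (1 / 2 * (ε / b) ^ (1 / (m : ℝ))) ^ m := by gcongr
    have h2 : ((ε / b) ^ (1 / (m : ℝ))) ^ m = ε / b := by
      rw [one_div, Real.rpow_inv_natCast_pow (by positivity) (by omega)]
    rw [mul_pow, h2] at h1
    have h3 : (1 / 2 : ℝ) ^ m ≤ (1 / 2) ^ 2 :=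
      pow_le_pow_of_le_one (by norm_num) (by norm_num) hm
    calc b * r ^ m ≤ b * ((1 / 2) ^ m * (ε / b)) := by gcongr
      _ ≤ b * ((1 / 2) ^ 2 * (ε / b)) := by gcongr
      _ = ε / 4 := by field_simp; norm_num
  have h1 := aux p L hp hL (hle.trans (by gcongr; exact min_le_left _ _))
  have h2 := aux P σ hP hσ (hle.trans (by gcongr; exact min_le_right _ _))
  linarith

end Run

/-! ### The step size bounds in the three cases -/

theorem mainTheorem5 (n p : ℕ) (hp : 3 ≤ p) (L : ℝ) (hL : 0 < L) (Λ : ℕ → ℝ)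
    (η γ₁ γ₂ σmin : ℝ) (hη : 0 < η) (hη' : η < 1) (hγ₁ : 1 < γ₁) (hγ₂ : 0 < γ₂)
    (hγ₂' : γ₂ < 1) (hσmin : 0 < σmin) :
    ∃ κ₃ κ₄ : ℝ, 0 < κ₃ ∧ 0 < κ₄ ∧
      ∀ (f : EuclideanSpace ℝ (Fin n) → ℝ), IsLipschitzSmooth p L f →
      ∀ ε a : ℝ, 0 < ε → ε < 1 → 0 ≤ a → a ≤ 1 / 2 →
      ∀ r : ARpSoSRun p f ε (ε ^ a) η γ₁ γ₂ σmin, r.DerivativesBounded Λ →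
      ∀ k : ℕ, IsActive f ε r.x k →
        (r.cvx k = ConvexityCase.stronglyConvex → ε < ‖gradient f (r.x k + r.s k)‖ →
          1 / 2 * min ((ε / L) ^ (1 / (p : ℝ)))
            ((ε / r.σ k) ^ (1 / ((regPower p : ℝ) - 1))) < ‖r.s k‖) ∧
        (r.cvx k = ConvexityCase.nonconvex → κ₃ * ε < ‖r.s k‖) ∧
        (r.cvx k = ConvexityCase.nearlyStronglyConvex → ε < ‖gradient f (r.x k + r.s k)‖ →
          κ₄ * ε ^ (1 - a) < ‖r.s k‖) := by
  obtain ⟨d, hd, hreg, hd1, hd2⟩ := exists_regPower_eq hp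
  obtain ⟨B, hB, hΛ⟩ : ∃ B : ℝ, 0 < B ∧ ∀ j ≤ p, Λ j ≤ B := by
    refine ⟨1 + ∑ j ∈ Finset.range (p + 1), |Λ j|, by positivity, fun j hj => ?_⟩
    have := Finset.single_le_sum (f := fun j => |Λ j|) (fun i _ => abs_nonneg (Λ i))
      (Finset.mem_range.2 (Nat.lt_succ_of_le hj))
    linarith [le_abs_self (Λ j)]
  obtain ⟨M, hM, hσM⟩ := exists_forall_σ_mul_le n hp hd hreg hd1 hd2 hL hB hη' hγ₁ hγ₂ hγ₂' hσmin
  obtain ⟨q, rfl⟩ : ∃ q, p = q + 1 := ⟨p - 1, by omega⟩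
  -- The bracket collects the coefficients in the estimate of `∇f(x_k)`: Taylor terms `q * B`, shift
  -- at most `B + 1`, regularizer `M`.
  obtain ⟨κ₃, hκ₃, hκ₃1, hκ₃M⟩ : ∃ κ : ℝ, 0 < κ ∧ κ ≤ 1 ∧ (q * B + (B + 1) + M) * κ ≤ 1 :=
    ⟨1 / (q * B + (B + 1) + M), by positivity,
      div_le_one_of_le₀ (by nlinarith [Nat.cast_nonneg (α := ℝ) q]) (by positivity),
      by rw [mul_one_div_cancel (by positivity)]⟩
  obtain ⟨κ₄, hκ₄, hκ₄1, hκ₄M⟩ : ∃ κ : ℝ, 0 < κ ∧ κ ≤ 1 ∧ (L + 1 + M) * κ ≤ 1 :=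
    ⟨1 / (L + 1 + M), by positivity, div_le_one_of_le₀ (by linarith) (by positivity),
      by rw [mul_one_div_cancel (by positivity)]⟩
  refine ⟨κ₃, κ₄, hκ₃, hκ₄, fun f hf ε a hε hε1 ha ha' => ?_⟩
  have hδ : 0 < ε ^ a := Real.rpow_pos_of_pos hε a
  have hδ1 : ε ^ a ≤ 1 := Real.rpow_le_one hε.le hε1.le ha
  have hεδ : ε ≤ ε ^ a * ε ^ a := by
    rw [← Real.rpow_add hε]
    calc ε = ε ^ (1 : ℝ) := (Real.rpow_one ε).symm
      _ ≤ ε ^ (a + a) := Real.rpow_le_rpow_of_exponent_ge hε hε1.le (by linarith)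
  have hsub : ε ^ (1 - a) = ε / ε ^ a := by rw [Real.rpow_sub hε, Real.rpow_one]
  rw [hsub]
  clear hsub
  -- From here on, `δ` enters only through `0 < δ ≤ 1`, `ε ≤ δ * δ` and the form `ε / δ` of the Case
  -- 3 bound.
  generalize ε ^ a = δ at *
  intro r hr k hk
  have hb : ∀ i ≤ k, ∀ j, 1 ≤ j → j ≤ q + 1 → ‖iteratedFDeriv ℝ j f (r.x i)‖ ≤ B :=
    fun i hi j h1 hj => (hr i (fun l hl => hk.mono (by omega)) j h1 hj).trans (hΛ j hj)
  have hσ0 := r.σ_pos (by linarith) hσmin hk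
  have hσ := hσM f ε δ r hf hε hδ hδ1 k hk hb
  have hf2 : ContDiff ℝ 2 f := hf.contDiff.of_le (by exact_mod_cast (by omega : 2 ≤ q + 1))
  have hc := r.cvx_spec k hk
  have hg := norm_gradient_add_le hf hL.le hreg hσ0.le (hc.shift_nonneg hδ) (r.s_spec k hk)
  have hact := hk k le_rfl
  set t := ‖r.s k‖ with ht
  have ht0 : 0 ≤ t := norm_nonneg _
  -- Trade `2 d - 1` of the powers of `t` for powers of `δ`, so that the bound on `σ_k` applies; two
  -- powers of `t` remain.
  have hreg_term : ∀ {b : ℝ}, t ≤ δ → t * t ≤ b → 0 ≤ b → r.σ k * t ^ (2 * d + 1) ≤ M * b := by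
    intro b h1 h2 hb0
    calc r.σ k * t ^ (2 * d + 1) = r.σ k * t ^ (2 * d - 1) * (t * t) := by
          rw [mul_assoc, ← sq, ← pow_add]; congr 2; omega
      _ ≤ r.σ k * δ ^ (2 * d - 1) * b := by gcongr
      _ ≤ M * b := by gcongr
  refine ⟨fun hcase hgrad => ?_, fun hcase => ?_, fun hcase hgrad => ?_⟩
  · rw [hcase] at hg
    have hP : ((regPower (q + 1) : ℕ) : ℝ) - 1 = ((2 * d + 1 : ℕ) : ℝ) := by
      rw [hreg]; push_cast; ring
    rw [hP]
    refine half_min_rpow_lt (by omega) (by omega) hL hσ0 hε ht0 (hgrad.trans_le (hg.trans ?_))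
    simp [ConvexityCase.shift]
  · by_contra! hle
    have hεδ' : ε ≤ δ := hεδ.trans (mul_le_of_le_one_left hδ.le hδ1)
    have htε : t ≤ ε := hle.trans (mul_le_of_le_one_left hε.le hκ₃1)
    have h1 := norm_gradient_le hf.contDiff hreg hσ0.le (hc.shift_nonneg hδ) (hb k le_rfl)
      (r.s_spec k hk) (htε.trans hε1.le)
    rw [hcase] at h1
    have hμ : ConvexityCase.nonconvex.shift δ (lambdaMin f (r.x k)) ≤ B + 1 :=
      add_le_add ((neg_lambdaMin_le hf2 _).trans (hb k le_rfl 2 (by omega) (by omega))) hδ1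
    have h2 : t * t ≤ κ₃ * ε := by
      calc t * t ≤ κ₃ * ε * 1 := by gcongr; exact htε.trans hε1.le
        _ = κ₃ * ε := mul_one _
    have h3 := hreg_term (htε.trans hεδ') h2 (by positivity)
    have h4 : (q * B + ConvexityCase.nonconvex.shift δ (lambdaMin f (r.x k))) * t ≤
        (q * B + (B + 1)) * (κ₃ * ε) := by gcongr
    have h5 : (q * B + (B + 1) + M) * κ₃ * ε ≤ 1 * ε := by gcongr
    linarith
  · by_contra! hle
    rw [hcase] at hg
    -- Here `a ≤ 1 / 2` is essential: a step of size at most `ε / δ` is then at most `δ`, as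
    -- `hreg_term` demands.
    have hεδ' : ε / δ ≤ δ := (div_le_iff₀ hδ).2 hεδ
    have htε : t ≤ ε / δ := hle.trans (mul_le_of_le_one_left (by positivity) hκ₄1)
    have htδ : t ≤ δ := htε.trans hεδ'
    have h2 : t * t ≤ κ₄ * ε := by
      calc t * t ≤ κ₄ * (ε / δ) * δ := by gcongr
        _ = κ₄ * ε := by field_simp
    have h3 := hreg_term htδ h2 (by positivity)
    have h4 : L * t ^ (q + 1) ≤ L * (κ₄ * ε) := by
      gcongr
      refine le_trans ?_ h2
      rw [← sq]
      exact pow_le_pow_of_le_one ht0 (htδ.trans hδ1) (by omega)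
    have h5 : δ * t ≤ κ₄ * ε := by
      calc δ * t ≤ δ * (κ₄ * (ε / δ)) := by gcongr
        _ = κ₄ * ε := by field_simp
    have h6 : (L + 1 + M) * κ₄ * ε ≤ 1 * ε := by gcongr
    simp only [ConvexityCase.shift] at hg
    linarith
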